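/- For $n\ge 1$ let $S_n$ be the symmetric group on $n$ letters and, for $\sigma\in S_n$, let $\alpha_j(\sigma)$ be the number of cycles of length $j$ of $\sigma$ (fixed points are cycles of length $1$). A sequence $\hat F(1),\hat F(2),\dots$ of numbers determines on every $S_m$ the multiplicative function $F(\sigma)=\prod_{j=1}^{m}\hat F(j)^{\alpha_j(\sigma)}$ (with $0^0=1$). For all real numbers $d^-,d^+$ with $0<d^-\le d^+$ there is a constant $c_1=c_1(d^-,d^+)>0$, depending on $d^-$ and $d^+$ only, such that the following holds for every $n\ge 1$, every real sequence $(\hat d(j))_{j\ge1}$ with $d^-\le\hat d(j)\le d^+$ for $1\le j\le n$, and every complex sequence $(\hat f(j))_{j\ge1}$ with $|\hat f(j)|\le 1$ for $1\le j\le n$. Let $d$ and $f$ be the multiplicative functions determined by $\hat d$ and $\hat f$, and put $$\nu_{n,d}(\sigma)=\frac{d(\sigma)}{\sum_{\tau\in S_n}d(\tau)},\qquad M_n^d(f)=\sum_{\sigma\in S_n}f(\sigma)\,\nu_{n,d}(\sigma),\qquad p_k=\frac1{k!}\sum_{\sigma\in S_k}d(\sigma)\quad(k\ge 0),$$ $$\Delta_n=\left|M_n^d(f)-\exp\left\{\sum_{j=1}^n\hat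 d(j)\frac{\hat f(j)-1}{j}\right\}\right| .$$ Then $p_k=[z^k]\exp\bigl\{\sum_{j=1}^\infty\frac{\hat d(j)}{j}z^j\bigr\}$ for all $k\ge 0$ (coefficient of the formal power series). If $d^-<1$, then $$\Delta_n\le c_1\left(\Bigl(\sum_{j=0}^np_j\Bigr)^{-1}\sum_{k=1}^n|\hat f(k)-1|\,p_{n-k}+\frac1{n^{d^-}}\sum_{k=1}^n|\hat f(k)-1|\,k^{d^--1}+\frac1n\sum_{k=1}^n|\hat f(k)-1|\right),$$ and if $d^-\ge 1$, then $$\Delta_n\le c_1\left(\Bigl(\sum_{j=0}^np_j\Bigr)^{-1}\sum_{k=1}^n|\hat f(k)-1|\,p_{n-k}+\frac1n\sum_{k=1}^n|\hat f(k)-1|\Bigl(1+\log\frac nk\Bigr)\right).$$ -/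

import Mathlib

open Finset

/-- `cycleCount σ j` is the number `α_j(σ)` of cycles of length `j` of the permutation `σ`
of an `n`-element set, fixed points being the cycles of length `1`. -/
def cycleCount {n : ℕ} (σ : Equiv.Perm (Fin n)) (j : ℕ) : ℕ :=
  σ.partition.parts.count j

/-- The multiplicative function on `S_n` determined by the values `F 1, …, F n`:
the product over `1 ≤ j ≤ n` of `F j ^ α_j(σ)`, with `0 ^ 0 = 1`. -/
def multFun {R : Type*} [CommMonoid R] (F : ℕ → R) {n : ℕ} (σ : Equiv.Perm (Fin n)) : R :=
  ∏ j ∈ Icc 1 n, F j ^ cycleCount σ j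

/-- The weight `ν_{n,d}(σ) = d(σ) / ∑_τ d(τ)` of `σ ∈ S_n`, where `d` is the multiplicative
function determined by `dhat`. -/
noncomputable def multMeasure (dhat : ℕ → ℝ) {n : ℕ} (σ : Equiv.Perm (Fin n)) : ℝ :=
  multFun dhat σ / ∑ τ : Equiv.Perm (Fin n), multFun dhat τ

/-- The weighted mean `M_n^d(f) = ∑_{σ ∈ S_n} f(σ) ν_{n,d}(σ)` of the multiplicative
function `f` determined by `fhat`. -/
noncomputable def weightedMean (dhat : ℕ → ℝ) (n : ℕ) (fhat : ℕ → ℂ) : ℂ :=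
  ∑ σ : Equiv.Perm (Fin n), multFun fhat σ * (multMeasure dhat σ : ℂ)

/-- `p_n = (1 / n!) ∑_{σ ∈ S_n} d(σ)`. -/
noncomputable def pCoeff (dhat : ℕ → ℝ) (n : ℕ) : ℝ :=
  (1 / (n.factorial : ℝ)) * ∑ σ : Equiv.Perm (Fin n), multFun dhat σ

/-- The formal power series `∑_{j ≥ 1} (d̂(j) / j) z ^ j`. -/
noncomputable def logSeries (dhat : ℕ → ℝ) : PowerSeries ℝ :=
  PowerSeries.mk fun j => if j = 0 then 0 else dhat j / (j : ℝ)

/-- The formal power series `exp {∑_{j ≥ 1} (d̂(j) / j) z ^ j}`: substitution of a series without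
constant term into the exponential series. -/
noncomputable def genSeries (dhat : ℕ → ℝ) : PowerSeries ℝ :=
  (PowerSeries.exp ℝ).subst (logSeries dhat)

/-- `Δ_n = |M_n^d(f) - exp {∑_{j ≤ n} d̂(j) (f̂(j) - 1) / j}|`. -/
noncomputable def meanError (dhat : ℕ → ℝ) (n : ℕ) (fhat : ℕ → ℂ) : ℝ :=
  ‖weightedMean dhat n fhat
    - Complex.exp (∑ j ∈ Icc 1 n, (dhat j : ℂ) * ((fhat j - 1) / (j : ℂ)))‖

/-! Write `expCoeff a n` for the coefficient of z^n in exp(∑ a(j) z^j / j). The cycle index formula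
(`sum_multFun`) gives p_n = `expCoeff d n` and turns the weighted mean into a quotient of two such
coefficients, so the problem is to compare [z^n] exp(∑ d(j) f(j) z^j / j) with p_n exp(L(1)), where
L(y) = ∑_{l ≤ n} d(l)(f(l) - 1) y^l / l.

The two are joined by a path. Let U_i(y) = [z^i] exp(∑ (d(j)(f(j) - 1) y^j + d(j)) z^j / j) and Φ(y)
= U_n(y) exp(L(1) - L(y)). Then Φ(1) and Φ(0) are the two quantities, and Φ'(y) = exp(L(1) - L(y))
∑_l d(l)(f(l) - 1) y^(l-1) (U_{n-l}(y) - U_n(y)). The exponential has modulus at most 1 because Re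
f(l) ≤ 1, so everything rests on the differences U_{n-l} - U_n.

Applying z d/dz to the generating series F of the U_i bounds n |U_n - U_{n-l}| by l |U_{n-l}| plus a
multiple of the ℓ¹ norm of (1 - z^l) F up to degree n (`natCast_mul_norm_sub_le`). With θ = min(1,
d⁻), F is split into a factor with exponents θ(1 - y^j) and a remainder. By Kaluza's criterion the
coefficients of the first factor are nonnegative and decreasing, so multiplying it by 1 - z^l leaves
an ℓ¹ norm of at most twice its first l coefficients. The remainder is majorized by the exponents
d(j) - θ + θ y^j (`truncNorm_one_sub_X_pow_mul_le`).

Two estimates normalize the result: removing θ from the exponents costs a factor n^θ in the partial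
sums (`sum_expCoeff_sub_le`), and these sums are O(n p_n) (`sum_expCoeff_le_mul`). Integration over
y gives l^(θ-1) for θ < 1 and 1 + log(n/l) for θ = 1, whence the two forms of the bound. -/

/-! ### Exponentials of power series and their coefficient recursion -/

section ExpSeries

variable {K : Type*} [Field K]

/-- The formal power series `∑_{j ≥ 1} a(j) z ^ j`. -/
noncomputable def symbolSeries (a : ℕ → K) : PowerSeries K :=
  PowerSeries.mk fun j => if j = 0 then 0 else a j

theorem hasSubst_logSeries (a : ℕ → K) : PowerSeries.HasSubst
    (PowerSeries.mk fun j => if j = 0 then 0 else a j / (j : K)) :=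
  PowerSeries.HasSubst.of_constantCoeff_zero' (by simp)

theorem coeff_symbolSeries_mul (a : ℕ → K) (f : PowerSeries K) (n : ℕ) :
    PowerSeries.coeff n (symbolSeries a * f) =
      ∑ j ∈ Icc 1 n, a j * PowerSeries.coeff (n - j) f := by
  rw [PowerSeries.coeff_mul, Nat.sum_antidiagonal_eq_sum_range_succ
    (fun i j => PowerSeries.coeff i (symbolSeries a) * PowerSeries.coeff j f),
    Finset.sum_range_succ']
  rw [show Icc 1 n = (range n).map (addRightEmbedding 1) by
    ext x; simp only [mem_Icc, mem_map, mem_range, addRightEmbedding_apply]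
    exact ⟨fun h => ⟨x - 1, by omega, by omega⟩, by rintro ⟨y, hy, rfl⟩; omega⟩]
  simp [symbolSeries]

theorem coeff_X_mul_derivative (f : PowerSeries K) (n : ℕ) :
    PowerSeries.coeff n (PowerSeries.X * PowerSeries.derivative K f) =
      n * PowerSeries.coeff n f := by
  cases n with
  | zero => simp
  | succ n => rw [PowerSeries.coeff_succ_X_mul, PowerSeries.coeff_derivative, mul_comm]; push_cast; rfl

variable [CharZero K]

/-- The formal power series `exp {∑_{j ≥ 1} (a(j) / j) z ^ j}`. -/
noncomputable def expSeries (a : ℕ → K) : PowerSeries K :=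
  (PowerSeries.exp K).subst (PowerSeries.mk fun j => if j = 0 then 0 else a j / (j : K))

/-- The coefficients of `expSeries a`. -/
noncomputable def expCoeff (a : ℕ → K) (n : ℕ) : K := PowerSeries.coeff n (expSeries a)

theorem constantCoeff_expSeries (a : ℕ → K) :
    PowerSeries.constantCoeff (expSeries a) = 1 := by
  have h : expSeries a = 1 + (PowerSeries.exp K - 1).subst
      (PowerSeries.mk fun j => if j = 0 then 0 else a j / (j : K)) := by
    rw [← PowerSeries.coe_substAlgHom (hasSubst_logSeries a), map_sub, map_one,
      PowerSeries.coe_substAlgHom, expSeries]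
    ring
  have h' : PowerSeries.constantCoeff ((PowerSeries.exp K - 1).subst
      (PowerSeries.mk fun j => if j = 0 then 0 else a j / (j : K))) = 0 :=
    PowerSeries.constantCoeff_subst_eq_zero
      (by change PowerSeries.constantCoeff _ = 0; simp) _ (by simp)
  rw [h, map_add, map_one, h', add_zero]

theorem X_mul_derivative_expSeries (a : ℕ → K) :
    PowerSeries.X * PowerSeries.derivative K (expSeries a) = symbolSeries a * expSeries a := by
  rw [expSeries, PowerSeries.derivative_subst (hasSubst_logSeries a), PowerSeries.derivative_exp,
    mul_comm _ (PowerSeries.derivative K _), ← mul_assoc]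
  congr 1
  ext n
  cases n with
  | zero => simp [symbolSeries]
  | succ n =>
    have : (n : K) + 1 ≠ 0 := by exact_mod_cast n.succ_ne_zero
    rw [PowerSeries.coeff_succ_X_mul, PowerSeries.coeff_derivative]
    simp only [symbolSeries, PowerSeries.coeff_mk, Nat.succ_ne_zero, if_false]
    push_cast
    field_simp

theorem expCoeff_zero (a : ℕ → K) : expCoeff a 0 = 1 := by
  simpa [expCoeff] using constantCoeff_expSeries a

theorem natCast_mul_expCoeff (a : ℕ → K) (n : ℕ) :
    (n : K) * expCoeff a n = ∑ j ∈ Icc 1 n, a j * expCoeff a (n - j) := by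
  simp only [expCoeff]
  rw [← coeff_X_mul_derivative, X_mul_derivative_expSeries, coeff_symbolSeries_mul]

/-- In characteristic zero the recursion determines each coefficient from the earlier ones. Asking
for it only up to `n` allows sequences that agree only there. -/
theorem expCoeff_eq_of_recursion {a c : ℕ → K} {n : ℕ} (h0 : c 0 = 1)
    (h : ∀ m ≤ n, 1 ≤ m → (m : K) * c m = ∑ j ∈ Icc 1 m, a j * c (m - j)) :
    expCoeff a n = c n := by
  induction n using Nat.strong_induction_on with
  | _ n ih =>
    rcases Nat.eq_zero_or_pos n with rfl | hn
    · rw [expCoeff_zero, h0]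
    · have hn' : (n : K) ≠ 0 := by exact_mod_cast hn.ne'
      apply mul_left_cancel₀ hn'
      rw [natCast_mul_expCoeff, h n le_rfl hn]
      refine Finset.sum_congr rfl fun j hj => ?_
      rw [mem_Icc] at hj
      rw [ih (n - j) (by omega) fun m hm => h m (by omega)]

theorem expCoeff_congr {a b : ℕ → K} {n : ℕ} (h : ∀ j ∈ Icc 1 n, a j = b j) :
    expCoeff a n = expCoeff b n := by
  refine expCoeff_eq_of_recursion (expCoeff_zero b) fun m hm _ => ?_
  rw [natCast_mul_expCoeff]
  refine Finset.sum_congr rfl fun j hj => ?_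
  rw [mem_Icc] at hj
  rw [h j (mem_Icc.2 ⟨hj.1, by omega⟩)]

theorem eq_expSeries {a : ℕ → K} {f : PowerSeries K} (h0 : PowerSeries.constantCoeff f = 1)
    (h : PowerSeries.X * PowerSeries.derivative K f = symbolSeries a * f) : f = expSeries a := by
  ext n
  refine (expCoeff_eq_of_recursion (c := fun n => PowerSeries.coeff n f) (by simpa using h0)
    fun m _ _ => ?_).symm
  rw [← coeff_X_mul_derivative, h, coeff_symbolSeries_mul]

theorem expSeries_add (a b : ℕ → K) :
    expSeries (fun j => a j + b j) = expSeries a * expSeries b := by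
  refine (eq_expSeries ?_ ?_).symm
  · rw [map_mul, constantCoeff_expSeries, constantCoeff_expSeries, one_mul]
  · have hs : symbolSeries (fun j => a j + b j) = symbolSeries a + symbolSeries b := by
      ext n
      by_cases hn : n = 0 <;> simp [symbolSeries, hn]
    rw [hs, Derivation.leibniz, smul_eq_mul, smul_eq_mul, mul_add]
    linear_combination expSeries a * X_mul_derivative_expSeries b +
      expSeries b * X_mul_derivative_expSeries a

theorem expCoeff_add (a b : ℕ → K) (n : ℕ) :
    expCoeff (fun j => a j + b j) n =
      ∑ i ∈ range (n + 1), expCoeff a i * expCoeff b (n - i) := by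
  simp only [expCoeff]
  rw [expSeries_add, PowerSeries.coeff_mul, Nat.sum_antidiagonal_eq_sum_range_succ
    (fun i j => PowerSeries.coeff i (expSeries a) * PowerSeries.coeff j (expSeries b))]

theorem expCoeff_mul_pow (a : ℕ → K) (y : K) (n : ℕ) :
    expCoeff (fun j => a j * y ^ j) n = expCoeff a n * y ^ n := by
  refine expCoeff_eq_of_recursion (c := fun n => expCoeff a n * y ^ n) (by simp [expCoeff_zero])
    fun m _ _ => ?_
  rw [← mul_assoc, natCast_mul_expCoeff, Finset.sum_mul]
  refine Finset.sum_congr rfl fun j hj => ?_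
  rw [mem_Icc] at hj
  obtain ⟨k, rfl⟩ := Nat.exists_eq_add_of_le hj.2
  rw [Nat.add_sub_cancel_left, pow_add]
  ring

theorem map_expCoeff {F : Type*} [Field F] [CharZero F] (φ : K →+* F) (a : ℕ → K) (n : ℕ) :
    φ (expCoeff a n) = expCoeff (fun j => φ (a j)) n := by
  refine (expCoeff_eq_of_recursion (c := fun n => φ (expCoeff a n)) (by simp [expCoeff_zero])
    fun m _ _ => ?_).symm
  rw [← map_natCast φ, ← map_mul, natCast_mul_expCoeff, map_sum]
  simp only [map_mul]

end ExpSeries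

theorem expCoeff_nonneg {a : ℕ → ℝ} (ha : ∀ j, 0 ≤ a j) (n : ℕ) : 0 ≤ expCoeff a n := by
  induction n using Nat.strong_induction_on with
  | _ n ih =>
    rcases Nat.eq_zero_or_pos n with rfl | hn
    · rw [expCoeff_zero]; exact zero_le_one
    · have hn' : (0 : ℝ) < n := by exact_mod_cast hn
      refine nonneg_of_mul_nonneg_right (b := expCoeff a n) ?_ hn'
      rw [natCast_mul_expCoeff]
      refine Finset.sum_nonneg fun j hj => mul_nonneg (ha j) (ih _ ?_)
      rw [mem_Icc] at hj
      omega

/-- Majorant principle: the recursion involves only sums and products, so bounds propagate by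
induction. -/
theorem norm_expCoeff_le {a : ℕ → ℂ} {b : ℕ → ℝ} (hab : ∀ j, ‖a j‖ ≤ b j) (n : ℕ) :
    ‖expCoeff a n‖ ≤ expCoeff b n := by
  induction n using Nat.strong_induction_on with
  | _ n ih =>
    rcases Nat.eq_zero_or_pos n with rfl | hn
    · simp [expCoeff_zero]
    · have hn' : (0 : ℝ) < n := by exact_mod_cast hn
      refine le_of_mul_le_mul_left ?_ hn'
      have : (n : ℝ) * ‖expCoeff a n‖ = ‖(n : ℂ) * expCoeff a n‖ := by simp
      rw [this, natCast_mul_expCoeff, natCast_mul_expCoeff]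
      refine (norm_sum_le _ _).trans (Finset.sum_le_sum fun j hj => ?_)
      rw [mem_Icc] at hj
      rw [norm_mul]
      exact mul_le_mul (hab j) (ih _ (by omega)) (norm_nonneg _) ((norm_nonneg _).trans (hab j))

theorem genSeries_eq_expSeries (a : ℕ → ℝ) : genSeries a = expSeries a := rfl

/-! ### The cycle index formula -/

section CycleIndex

variable {K : Type*} [Field K]

/-- The weight `∏_j (a(j) / j) ^ m_j / m_j!` of a multiset containing `j` with multiplicity
`m_j`. -/
noncomputable def cycleWeight (a : ℕ → K) (s : Multiset ℕ) : K :=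
  ∏ j ∈ s.toFinset, (a j / (j : K)) ^ s.count j / ((s.count j).factorial : K)

theorem cycleWeight_eq_prod (a : ℕ → K) {s : Multiset ℕ} {T : Finset ℕ} (h : s.toFinset ⊆ T) :
    cycleWeight a s = ∏ j ∈ T, (a j / (j : K)) ^ s.count j / ((s.count j).factorial : K) := by
  refine Finset.prod_subset h fun j _ hj => ?_
  rw [Multiset.mem_toFinset] at hj
  simp [Multiset.count_eq_zero_of_notMem hj]

theorem cycleWeight_cons [CharZero K] (a : ℕ → K) (s : Multiset ℕ) {j : ℕ} (hj : j ≠ 0) :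
    (((j ::ₘ s).count j : ℕ) : K) * (j : K) * cycleWeight a (j ::ₘ s) = a j * cycleWeight a s := by
  have hj' : (j : K) ≠ 0 := by exact_mod_cast hj
  have hs : s.toFinset ⊆ (j ::ₘ s).toFinset := by
    intro x hx
    simp only [Multiset.mem_toFinset, Multiset.mem_cons] at hx ⊢
    exact Or.inr hx
  rw [cycleWeight, cycleWeight_eq_prod a hs]
  have hmem : j ∈ (j ::ₘ s).toFinset := by simp
  rw [← Finset.mul_prod_erase _ _ hmem, ← Finset.mul_prod_erase (j ::ₘ s).toFinset
    (fun i => (a i / (i : K)) ^ s.count i / ((s.count i).factorial : K)) hmem]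
  have hrest : ∀ i ∈ (j ::ₘ s).toFinset.erase j,
      (a i / (i : K)) ^ (j ::ₘ s).count i / (((j ::ₘ s).count i).factorial : K) =
        (a i / (i : K)) ^ s.count i / ((s.count i).factorial : K) := by
    intro i hi
    rw [Multiset.count_cons_of_ne (Finset.ne_of_mem_erase hi)]
  rw [Finset.prod_congr rfl hrest, Multiset.count_cons_self, Nat.factorial_succ, pow_succ]
  have h1 : ((s.count j + 1 : ℕ) : K) ≠ 0 := by exact_mod_cast (s.count j).succ_ne_zero
  have h2 : ((s.count j).factorial : K) ≠ 0 := by exact_mod_cast Nat.factorial_ne_zero _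
  push_cast at h1 ⊢
  field_simp

/-- Deleting one part `j` is a bijection from the partitions of `n` containing `j` to the partitions
of `n - j`; the multiplicity factor kills the other partitions and absorbs the change of factorial.
-/
theorem sum_partition_count_mul [CharZero K] (a : ℕ → K) {n j : ℕ} (hj : j ∈ Icc 1 n) :
    ∑ l : n.Partition, ((l.parts.count j : ℕ) : K) * (j : K) * cycleWeight a l.parts =
      a j * ∑ l : (n - j).Partition, cycleWeight a l.parts := by
  rw [mem_Icc] at hj
  rw [Finset.mul_sum, ← Finset.sum_filter_of_ne (p := fun l : n.Partition => j ∈ l.parts)]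
  · symm
    refine Finset.sum_bij' (fun (l : (n - j).Partition) _ => (⟨j ::ₘ l.parts, ?_, ?_⟩ : n.Partition))
      (fun (l : n.Partition) hl => (⟨l.parts.erase j, ?_, ?_⟩ : (n - j).Partition)) ?_ ?_ ?_ ?_ ?_
    · intro i hi
      rcases Multiset.mem_cons.1 hi with rfl | hi
      · omega
      · exact l.parts_pos hi
    · rw [Multiset.sum_cons, l.parts_sum]; omega
    · intro i hi
      exact l.parts_pos (Multiset.mem_of_mem_erase hi)
    · have hl' : j ∈ l.parts := (Finset.mem_filter.1 hl).2
      have := Multiset.sum_erase hl'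
      have h2 := l.parts_sum
      omega
    · intro l _; simp
    · intro l _; simp
    · intro l _; simp
    · intro l hl
      ext1
      exact Multiset.cons_erase (Finset.mem_filter.1 hl).2
    · intro l _
      exact (cycleWeight_cons a l.parts (by omega)).symm
  · intro l _ hne
    by_contra hmem
    exact hne (by simp [Multiset.count_eq_zero_of_notMem hmem])

theorem sum_partition_cycleWeight [CharZero K] (a : ℕ → K) (n : ℕ) :
    ∑ l : n.Partition, cycleWeight a l.parts = expCoeff a n := by
  refine (expCoeff_eq_of_recursion
    (c := fun n => ∑ l : n.Partition, cycleWeight a l.parts) ?_ fun m _ _ => ?_).symm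
  · simp [cycleWeight]
  -- Double counting: the parts of a partition of `m` satisfy ∑ j m_j = `m`, which produces the left
  -- side of the recursion.
  · rw [← Finset.sum_congr rfl fun j hj => sum_partition_count_mul a hj, Finset.sum_comm,
      Finset.mul_sum]
    refine Finset.sum_congr rfl fun l _ => ?_
    rw [← Finset.sum_mul]
    congr 1
    have hsum : ∑ j ∈ l.parts.toFinset, l.parts.count j • j = m := by
      rw [← Finset.sum_multiset_count, l.parts_sum]
    rw [Finset.sum_subset (s₂ := Icc 1 m)] at hsum
    · conv_lhs => rw [← hsum]
      push_cast [smul_eq_mul]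
      rfl
    · intro j hj
      rw [Multiset.mem_toFinset] at hj
      exact mem_Icc.2 ⟨l.parts_pos hj, Nat.Partition.le_of_mem_parts hj⟩
    · intro j _ hj
      rw [Multiset.mem_toFinset] at hj
      simp [Multiset.count_eq_zero_of_notMem hj]

theorem Nat.Partition.parts_eq_filter_add_replicate {n : ℕ} (l : n.Partition) :
    l.parts = l.parts.filter (2 ≤ ·) + Multiset.replicate (l.parts.count 1) 1 := by
  ext i
  rw [Multiset.count_add, Multiset.count_filter, Multiset.count_replicate]
  rcases Nat.lt_or_ge i 2 with hi | hi
  · interval_cases i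
    · have : (0 : ℕ) ∉ l.parts := fun h => (l.parts_pos h).ne' rfl
      simp [Multiset.count_eq_zero_of_notMem this]
    · simp
  · simp [hi, show (1 : ℕ) ≠ i by omega]

variable {α : Type*} [Fintype α] [DecidableEq α]

/-- The cycle type omits fixed points, but the number of parts equal to 1 is forced by the total
sum. -/
theorem Equiv.Perm.partition_eq_iff (σ : Equiv.Perm α) (l : (Fintype.card α).Partition) :
    σ.partition = l ↔ σ.cycleType = l.parts.filter (2 ≤ ·) := by
  constructor
  · rintro rfl
    exact Equiv.Perm.filter_parts_partition_eq_cycleType.symm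
  · intro h
    ext1
    rw [Equiv.Perm.parts_partition, ← Equiv.Perm.sum_cycleType, h]
    conv_rhs => rw [l.parts_eq_filter_add_replicate]
    congr 2
    have := congrArg Multiset.sum l.parts_eq_filter_add_replicate
    rw [l.parts_sum, Multiset.sum_add, Multiset.sum_replicate] at this
    simp only [smul_eq_mul, mul_one] at this
    omega

theorem card_filter_partition_eq_mul (l : (Fintype.card α).Partition) :
    #{σ : Equiv.Perm α | σ.partition = l} *
      (l.parts.prod * ∏ j ∈ l.parts.toFinset, (l.parts.count j).factorial) =
        (Fintype.card α).factorial := by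
  have hsum := congrArg Multiset.sum l.parts_eq_filter_add_replicate
  rw [l.parts_sum, Multiset.sum_add, Multiset.sum_replicate, smul_eq_mul, mul_one] at hsum
  have hprod := congrArg Multiset.prod l.parts_eq_filter_add_replicate
  rw [Multiset.prod_add, Multiset.prod_replicate, one_pow, mul_one] at hprod
  have hcard := Equiv.Perm.card_of_cycleType_mul_eq α (l.parts.filter (2 ≤ ·))
  rw [if_pos ⟨by omega, fun i hi => (Multiset.mem_filter.1 hi).2⟩,
    show Fintype.card α - (l.parts.filter (2 ≤ ·)).sum = l.parts.count 1 by omega] at hcard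
  rw [← hcard, hprod]
  simp only [Equiv.Perm.partition_eq_iff]
  have hfac : ∏ j ∈ l.parts.toFinset, (l.parts.count j).factorial = (l.parts.count 1).factorial *
      ∏ j ∈ (l.parts.filter (2 ≤ ·)).toFinset,
        ((l.parts.filter (2 ≤ ·)).count j).factorial := by
    have hsub : l.parts.toFinset ⊆ insert 1 (l.parts.filter (2 ≤ ·)).toFinset := by
      intro j hj
      rw [Multiset.mem_toFinset] at hj
      have := l.parts_pos hj
      rw [Finset.mem_insert, Multiset.mem_toFinset, Multiset.mem_filter]
      by_cases h1 : j = 1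
      · exact Or.inl h1
      · exact Or.inr ⟨hj, by omega⟩
    rw [Finset.prod_subset hsub, Finset.prod_insert]
    · congr 1
      refine Finset.prod_congr rfl fun j hj => ?_
      rw [Multiset.mem_toFinset, Multiset.mem_filter] at hj
      rw [Multiset.count_filter, if_pos hj.2]
    · simp
    · intro j _ hj
      rw [Multiset.mem_toFinset] at hj
      simp [Multiset.count_eq_zero_of_notMem hj]
  rw [hfac]
  ring

theorem sum_perm_prod_pow_count [CharZero K] (a : ℕ → K) :
    ∑ σ : Equiv.Perm α, ∏ j ∈ Icc 1 (Fintype.card α), a j ^ σ.partition.parts.count j =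
      ((Fintype.card α).factorial : K) * expCoeff a (Fintype.card α) := by
  rw [← sum_partition_cycleWeight, Finset.mul_sum,
    ← Finset.sum_fiberwise Finset.univ (fun σ : Equiv.Perm α => σ.partition)]
  refine Finset.sum_congr rfl fun l _ => ?_
  rw [Finset.sum_congr rfl (g := fun _ => ∏ j ∈ Icc 1 (Fintype.card α), a j ^ l.parts.count j)
    (fun σ hσ => by rw [(Finset.mem_filter.1 hσ).2]), Finset.sum_const, nsmul_eq_mul]
  have hsub : l.parts.toFinset ⊆ Icc 1 (Fintype.card α) := by
    intro j hj
    rw [Multiset.mem_toFinset] at hj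
    exact mem_Icc.2 ⟨l.parts_pos hj, Nat.Partition.le_of_mem_parts hj⟩
  rw [← Finset.prod_subset hsub (fun j _ hj => by
    rw [Multiset.mem_toFinset] at hj
    simp [Multiset.count_eq_zero_of_notMem hj])]
  rw [← card_filter_partition_eq_mul l, Finset.prod_multiset_count, cycleWeight]
  simp only [Finset.prod_div_distrib, div_pow]
  push_cast
  have h1 : ∏ j ∈ l.parts.toFinset, (j : K) ^ l.parts.count j ≠ 0 := by
    refine Finset.prod_ne_zero_iff.2 fun j hj => pow_ne_zero _ ?_
    rw [Multiset.mem_toFinset] at hj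
    exact_mod_cast (l.parts_pos hj).ne'
  have h2 : ∏ j ∈ l.parts.toFinset, ((l.parts.count j).factorial : K) ≠ 0 :=
    Finset.prod_ne_zero_iff.2 fun j _ => by exact_mod_cast Nat.factorial_ne_zero _
  field_simp

theorem sum_multFun [CharZero K] (a : ℕ → K) (n : ℕ) :
    ∑ σ : Equiv.Perm (Fin n), multFun a σ = (n.factorial : K) * expCoeff a n := by
  have h := sum_perm_prod_pow_count (α := Fin n) a
  simp only [Fintype.card_fin] at h
  exact h

end CycleIndex

theorem pCoeff_eq_expCoeff (a : ℕ → ℝ) (n : ℕ) : pCoeff a n = expCoeff a n := by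
  have h : (n.factorial : ℝ) ≠ 0 := by exact_mod_cast Nat.factorial_ne_zero _
  rw [pCoeff, sum_multFun]
  field_simp

theorem weightedMean_eq (d : ℕ → ℝ) (n : ℕ) (f : ℕ → ℂ) :
    weightedMean d n f = expCoeff (fun j => (d j : ℂ) * f j) n / ((expCoeff d n : ℝ) : ℂ) := by
  have h : (n.factorial : ℂ) ≠ 0 := by exact_mod_cast Nat.factorial_ne_zero _
  simp only [weightedMean, multMeasure]
  push_cast
  rw [Finset.sum_congr rfl (g := fun σ => multFun (fun j => (d j : ℂ) * f j) σ /
    ((∑ τ : Equiv.Perm (Fin n), multFun d τ : ℝ) : ℂ)) (fun σ _ => by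
      simp only [multFun, mul_pow, Finset.prod_mul_distrib]
      push_cast
      ring), ← Finset.sum_div, sum_multFun, sum_multFun]
  push_cast
  rw [mul_div_mul_left _ _ h]

/-! ### A submultiplicative truncated ℓ¹ norm -/

section TruncNorm

variable {K : Type*} [NormedField K]

/-- The sum of the norms of the coefficients of index at most `n`. -/
noncomputable def truncNorm (n : ℕ) (f : PowerSeries K) : ℝ :=
  ∑ i ∈ range (n + 1), ‖PowerSeries.coeff i f‖

theorem truncNorm_nonneg (n : ℕ) (f : PowerSeries K) : 0 ≤ truncNorm n f :=
  Finset.sum_nonneg fun _ _ => norm_nonneg _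

theorem truncNorm_mul_le (n : ℕ) (f g : PowerSeries K) :
    truncNorm n (f * g) ≤ truncNorm n f * truncNorm n g := by
  calc truncNorm n (f * g)
      ≤ ∑ m ∈ range (n + 1), ∑ i ∈ range (m + 1),
          ‖PowerSeries.coeff i f‖ * ‖PowerSeries.coeff (m - i) g‖ := by
        refine Finset.sum_le_sum fun m _ => ?_
        rw [PowerSeries.coeff_mul, Nat.sum_antidiagonal_eq_sum_range_succ
          (fun i j => PowerSeries.coeff i f * PowerSeries.coeff j g)]
        refine (norm_sum_le _ _).trans (le_of_eq ?_)
        simp only [norm_mul]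
    _ = ∑ i ∈ range (n + 1), ∑ m ∈ range (n + 1 - i),
          ‖PowerSeries.coeff i f‖ * ‖PowerSeries.coeff m g‖ :=
        Finset.sum_range_diag_flip (n + 1)
          fun i m => ‖PowerSeries.coeff i f‖ * ‖PowerSeries.coeff m g‖
    _ ≤ ∑ i ∈ range (n + 1), ∑ m ∈ range (n + 1),
          ‖PowerSeries.coeff i f‖ * ‖PowerSeries.coeff m g‖ := by
        refine Finset.sum_le_sum fun i _ => Finset.sum_le_sum_of_subset_of_nonneg ?_ ?_
        · intro x hx
          simp only [mem_range] at hx ⊢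
          omega
        · intro _ _ _; positivity
    _ = truncNorm n f * truncNorm n g := by
        rw [truncNorm, truncNorm, Finset.sum_mul_sum]

theorem truncNorm_pow_le (n k : ℕ) (f : PowerSeries K) :
    truncNorm n (f ^ k) ≤ truncNorm n f ^ k := by
  induction k with
  | zero =>
    rw [pow_zero, pow_zero, truncNorm, Finset.sum_range_succ']
    simp [PowerSeries.coeff_one]
  | succ k ih =>
    rw [pow_succ, pow_succ]
    exact (truncNorm_mul_le _ _ _).trans
      (mul_le_mul_of_nonneg_right ih (truncNorm_nonneg _ _))

end TruncNorm

theorem coeff_pow_eq_zero_of_lt {R : Type*} [CommRing R] {f : PowerSeries R}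
    (h : PowerSeries.constantCoeff f = 0) {i k : ℕ} (hik : i < k) :
    PowerSeries.coeff i (f ^ k) = 0 :=
  PowerSeries.X_pow_dvd_iff.1 (pow_dvd_pow_of_dvd (PowerSeries.X_dvd_iff.2 h) k) i hik

/-- The `k`-th power of a series without constant term starts at degree `k`, so powers beyond `n` do
not contribute. -/
theorem expCoeff_eq_sum (a : ℕ → ℝ) {i n : ℕ} (hin : i ≤ n) :
    expCoeff a i = ∑ k ∈ range (n + 1), (1 / (k.factorial : ℝ)) *
      PowerSeries.coeff i ((PowerSeries.mk fun j => if j = 0 then 0 else a j / (j : ℝ)) ^ k) := by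
  rw [expCoeff, expSeries, PowerSeries.coeff_subst' (hasSubst_logSeries a),
    finsum_eq_sum_of_support_subset (s := range (n + 1))]
  · refine Finset.sum_congr rfl fun k _ => ?_
    rw [PowerSeries.coeff_exp, smul_eq_mul]
    simp
  · intro k hk
    rw [Finset.mem_coe, mem_range]
    by_contra hlt
    refine hk ?_
    dsimp only
    rw [coeff_pow_eq_zero_of_lt (by simp) (by omega), smul_zero]

/-- Submultiplicativity of `truncNorm` bounds the `k`-th term of the exponential by the `k`-th term
of a real exponential series. -/
theorem sum_expCoeff_le_exp {a : ℕ → ℝ} (ha : ∀ j, 0 ≤ a j) (n : ℕ) :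
    ∑ i ∈ range (n + 1), expCoeff a i ≤ Real.exp (∑ j ∈ Icc 1 n, a j / j) := by
  set f : PowerSeries ℝ := PowerSeries.mk fun j => if j = 0 then 0 else a j / (j : ℝ) with hf
  have hnorm : truncNorm n f = ∑ j ∈ Icc 1 n, a j / j := by
    rw [truncNorm, Finset.sum_range_succ', show Icc 1 n = (range n).map (addRightEmbedding 1) by
      ext x; simp only [mem_Icc, mem_map, mem_range, addRightEmbedding_apply]
      exact ⟨fun h => ⟨x - 1, by omega, by omega⟩, by rintro ⟨y, hy, rfl⟩; omega⟩]
    simp only [hf, PowerSeries.coeff_mk, Finset.sum_map, addRightEmbedding_apply,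
      Nat.succ_ne_zero, if_false, if_true, norm_zero, add_zero]
    refine Finset.sum_congr rfl fun j _ => Real.norm_of_nonneg (div_nonneg (ha _) (by positivity))
  calc ∑ i ∈ range (n + 1), expCoeff a i
      = ∑ k ∈ range (n + 1), ∑ i ∈ range (n + 1),
          (1 / (k.factorial : ℝ)) * PowerSeries.coeff i (f ^ k) := by
        rw [Finset.sum_comm]
        exact Finset.sum_congr rfl fun i hi =>
          expCoeff_eq_sum a (Nat.lt_succ_iff.1 (mem_range.1 hi))
    _ ≤ ∑ k ∈ range (n + 1), truncNorm n f ^ k / k.factorial := by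
        refine Finset.sum_le_sum fun k _ => ?_
        rw [← Finset.mul_sum, one_div, inv_mul_eq_div]
        gcongr
        refine (Finset.sum_le_sum fun i _ => ?_).trans (truncNorm_pow_le n k f)
        exact le_abs_self _
    _ ≤ Real.exp (truncNorm n f) := Real.sum_le_exp_of_nonneg (truncNorm_nonneg _ _) _
    _ = _ := by rw [hnorm]

/-- Kaluza's criterion, for the exponential of a series with log-convex negative coefficients. -/
theorem expCoeff_neg_nonpos {e : ℕ → ℝ} (h0 : e 0 = 1) (hpos : ∀ j, 0 < e j)
    (hconv : ∀ i j, j ≤ i → e i * e (j + 1) ≤ e (i + 1) * e j) {n : ℕ} (hn : 1 ≤ n) :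
    expCoeff (fun j => -e j) n ≤ 0 := by
  set q := expCoeff (fun j => -e j) with hq
  have hrec : ∀ m : ℕ, (m : ℝ) * q m = -∑ j ∈ range m, e (m - j) * q j := by
    intro m
    rw [hq, natCast_mul_expCoeff, ← Finset.sum_neg_distrib]
    refine Finset.sum_bij' (fun j _ => m - j) (fun j _ => m - j) ?_ ?_ ?_ ?_ ?_
    · intro j hj; rw [mem_Icc] at hj; rw [mem_range]; omega
    · intro j hj; rw [mem_range] at hj; rw [mem_Icc]; omega
    · intro j hj; rw [mem_Icc] at hj; omega
    · intro j hj; rw [mem_range] at hj; omega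
    · intro j hj
      rw [mem_Icc] at hj
      rw [show m - (m - j) = j by omega, neg_mul]
  induction n using Nat.strong_induction_on with
  | _ n ih =>
    obtain ⟨i, rfl⟩ := Nat.exists_eq_add_of_le' hn
    rcases Nat.eq_zero_or_pos i with rfl | hi
    · have := hrec 1
      have hq0 : q 0 = 1 := expCoeff_zero _
      simp only [Finset.sum_range_one, hq0, Nat.cast_one] at this
      have h1 := hpos 1
      simp only [zero_add]
      linarith
    · have h1 := hrec (i + 1)
      have h2 := hrec i
      rw [Finset.sum_range_succ, show i + 1 - i = 1 by omega] at h1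
      have hqi : q i ≤ 0 := ih i (by omega) hi
      -- Eliminate between the recursions at i + 1 and i, weighted by e(i) and e(i + 1). The j = 0
      -- term, the only one with positive q(j), cancels exactly; the others are nonpositive by
      -- log-convexity and induction.
      have h3 : ∑ j ∈ range i, (e (i + 1) * e (i - j) - e i * e (i + 1 - j)) * q j ≤ 0 := by
        refine Finset.sum_nonpos fun j hj => ?_
        rw [mem_range] at hj
        rcases Nat.eq_zero_or_pos j with rfl | hj0
        · simp [mul_comm]
        · refine mul_nonpos_of_nonneg_of_nonpos ?_ (ih j (by omega) hj0)
          have := hconv i (i - j) (by omega)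
          rw [show i - j + 1 = i + 1 - j by omega] at this
          linarith
      have h4 : ∑ j ∈ range i, (e (i + 1) * e (i - j) - e i * e (i + 1 - j)) * q j =
          e (i + 1) * ∑ j ∈ range i, e (i - j) * q j -
            e i * ∑ j ∈ range i, e (i + 1 - j) * q j := by
        rw [Finset.mul_sum, Finset.mul_sum, ← Finset.sum_sub_distrib]
        exact Finset.sum_congr rfl fun j _ => by ring
      have h5 : e i * e 1 ≤ e (i + 1) := by simpa [h0] using hconv i 0 (by omega)
      have hi1 : (1 : ℝ) ≤ i := by exact_mod_cast hi
      have h6 : 0 ≤ i * e (i + 1) - e i * e 1 := by nlinarith [hpos (i + 1)]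
      have h7 : e i * ((i + 1 : ℕ) * q (i + 1)) ≤ (i * e (i + 1) - e i * e 1) * q i := by
        have h8 : e i * (((i + 1 : ℕ) : ℝ) * q (i + 1)) =
            e i * (-(∑ j ∈ range i, e (i + 1 - j) * q j + e 1 * q i)) := by rw [h1]
        have h9 : e (i + 1) * ((i : ℝ) * q i) =
            e (i + 1) * -∑ j ∈ range i, e (i - j) * q j := by rw [h2]
        rw [h4] at h3
        linarith
      have h8 : e i * ((i + 1 : ℕ) * q (i + 1)) ≤ 0 :=
        h7.trans (mul_nonpos_of_nonneg_of_nonpos h6 hqi)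
      have h9 : 0 < e i * ((i + 1 : ℕ) : ℝ) := mul_pos (hpos i) (by positivity)
      by_contra hcon
      push Not at hcon
      have := mul_pos h9 hcon
      linarith

theorem expCoeff_one (n : ℕ) : expCoeff (fun _ => (1 : ℝ)) n = 1 := by
  refine expCoeff_eq_of_recursion (c := fun _ => 1) rfl fun m _ _ => ?_
  simp

/-! ### Monotone coefficients and the variation of a perturbed series -/

section Smoothing

variable {θ y : ℝ}

/-- Since exp(∑ z^j / j) = 1/(1 - z), these coefficients are partial sums of those with exponents
-(1 - θ + θ y^j). The sequence 1 - θ + θ y^j is log-convex, so Kaluza's criterion makes every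
increment nonpositive. -/
theorem antitone_expCoeff (hθ0 : 0 ≤ θ) (hθ1 : θ ≤ 1) (hy0 : 0 < y) (hy1 : y ≤ 1) :
    Antitone (expCoeff fun j => θ * (1 - y ^ j)) := by
  have hfun : (fun j : ℕ => θ * (1 - y ^ j)) = fun j => -(1 - θ + θ * y ^ j) + 1 := by
    ext j; ring
  have hsum : ∀ n, expCoeff (fun j => θ * (1 - y ^ j)) n =
      ∑ i ∈ range (n + 1), expCoeff (fun j => -(1 - θ + θ * y ^ j)) i := by
    intro n
    rw [hfun, expCoeff_add (fun j => -(1 - θ + θ * y ^ j)) (fun _ => 1)]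
    simp [expCoeff_one]
  refine antitone_nat_of_succ_le fun n => ?_
  rw [hsum, hsum, Finset.sum_range_succ _ (n + 1)]
  have := expCoeff_neg_nonpos (e := fun j => 1 - θ + θ * y ^ j) (by simp) (fun j => ?_)
    (fun i j hij => ?_) (n := n + 1) (by omega)
  · linarith
  · have hyj : 0 < y ^ j := pow_pos hy0 j
    rcases hθ0.eq_or_lt with rfl | hθ
    · simp
    · have := mul_pos hθ hyj
      linarith
  · have hyij : y ^ i ≤ y ^ j := pow_le_pow_of_le_one hy0.le hy1 hij
    have : 0 ≤ (1 - θ) * θ * (1 - y) * (y ^ j - y ^ i) :=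
      mul_nonneg (mul_nonneg (mul_nonneg (by linarith) hθ0) (by linarith)) (by linarith)
    simp only [pow_succ]
    nlinarith

/-- For a decreasing sequence the differences beyond index `l` have constant sign and telescope,
leaving at most one more copy of the first `l` terms. -/
theorem sum_abs_sub_shift_le {h : ℕ → ℝ} (hanti : Antitone h) (hpos : ∀ i, 0 ≤ h i) {l n : ℕ}
    (hln : l ≤ n) :
    ∑ i ∈ range (n + 1), |h i - if l ≤ i then h (i - l) else 0| ≤ 2 * ∑ i ∈ range l, h i := by
  obtain ⟨m, rfl⟩ := Nat.exists_eq_add_of_le hln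
  rw [show l + m + 1 = l + (m + 1) by ring, Finset.sum_range_add]
  have h1 : ∑ i ∈ range l, |h i - if l ≤ i then h (i - l) else 0| = ∑ i ∈ range l, h i := by
    refine Finset.sum_congr rfl fun i hi => ?_
    rw [mem_range] at hi
    rw [if_neg (by omega), sub_zero, abs_of_nonneg (hpos i)]
  have h2 : ∑ i ∈ range (m + 1), |h (l + i) - if l ≤ l + i then h (l + i - l) else 0| =
      ∑ i ∈ range (m + 1), h i - ∑ i ∈ range (m + 1), h (l + i) := by
    rw [← Finset.sum_sub_distrib]
    refine Finset.sum_congr rfl fun i _ => ?_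
    rw [if_pos (by omega), Nat.add_sub_cancel_left, abs_sub_comm, abs_of_nonneg]
    linarith [hanti (show i ≤ l + i by omega)]
  have h3 : ∑ i ∈ range (m + 1), h i ≤
      ∑ i ∈ range l, h i + ∑ i ∈ range (m + 1), h (l + i) := by
    rw [← Finset.sum_range_add]
    exact Finset.sum_le_sum_of_subset_of_nonneg (by
      intro x hx; simp only [mem_range] at hx ⊢; omega) fun i _ _ => hpos i
  rw [h1, h2]
  linarith

theorem coeff_one_sub_X_pow_mul {R : Type*} [CommRing R] (f : PowerSeries R) (l i : ℕ) :
    PowerSeries.coeff i ((1 - PowerSeries.X ^ l) * f) =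
      PowerSeries.coeff i f - if l ≤ i then PowerSeries.coeff (i - l) f else 0 := by
  rw [sub_mul, one_mul, map_sub, PowerSeries.coeff_X_pow_mul']

/-- Only the factor with exponents θ(1 - y^j) meets 1 - z^l, where monotonicity gives the saving;
the remaining factor is estimated in norm through its majorant. -/
theorem truncNorm_one_sub_X_pow_mul_le {b : ℕ → ℝ} {u : ℕ → ℂ} (hθ0 : 0 ≤ θ) (hθ1 : θ ≤ 1)
    (hy0 : 0 < y) (hy1 : y ≤ 1) (hb : ∀ j, 0 ≤ b j)
    (hu : ∀ j, ‖u j - ((θ * (1 - y ^ j) : ℝ) : ℂ)‖ ≤ b j + θ * y ^ j) {l n : ℕ} (hl : 1 ≤ l)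
    (hln : l ≤ n) :
    truncNorm n ((1 - PowerSeries.X ^ l) * expSeries u) ≤
      2 * Real.exp (θ * (∑ j ∈ Icc 1 (l - 1), (1 - y ^ j) / j + ∑ j ∈ Icc 1 n, y ^ j / j)) *
        ∑ i ∈ range (n + 1), expCoeff b i := by
  set h : ℕ → ℝ := fun j => θ * (1 - y ^ j) with hh
  have hh0 : ∀ j, 0 ≤ h j := fun j =>
    mul_nonneg hθ0 (by linarith [pow_le_one₀ (n := j) hy0.le hy1])
  have hsplit : expSeries u = expSeries (fun j => (h j : ℂ)) * expSeries (fun j => u j - h j) := by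
    rw [← expSeries_add]
    congr 1
    ext j
    ring
  have h1 : truncNorm n ((1 - PowerSeries.X ^ l) * expSeries fun j => (h j : ℂ)) ≤
      2 * Real.exp (θ * ∑ j ∈ Icc 1 (l - 1), (1 - y ^ j) / j) := by
    have hc : ∀ i, PowerSeries.coeff i (expSeries fun j => (h j : ℂ)) = (expCoeff h i : ℝ) :=
      fun i => (map_expCoeff Complex.ofRealHom h i).symm
    calc truncNorm n ((1 - PowerSeries.X ^ l) * expSeries fun j => (h j : ℂ))
        = ∑ i ∈ range (n + 1), |expCoeff h i - if l ≤ i then expCoeff h (i - l) else 0| := by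
          refine Finset.sum_congr rfl fun i _ => ?_
          rw [coeff_one_sub_X_pow_mul, hc, hc, ← Real.norm_eq_abs, ← Complex.norm_real]
          split_ifs <;> simp
      _ ≤ 2 * ∑ i ∈ range l, expCoeff h i :=
          sum_abs_sub_shift_le (antitone_expCoeff hθ0 hθ1 hy0 hy1) (expCoeff_nonneg hh0) hln
      _ ≤ _ := by
          have := sum_expCoeff_le_exp hh0 (l - 1)
          rw [show l - 1 + 1 = l by omega] at this
          refine mul_le_mul_of_nonneg_left (this.trans (le_of_eq ?_)) (by norm_num)
          rw [Finset.mul_sum]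
          congr 1
          exact Finset.sum_congr rfl fun j _ => by rw [hh]; ring
  have hy : ∀ j, 0 ≤ θ * y ^ j := fun j => by positivity
  have h2 : truncNorm n (expSeries fun j => u j - h j) ≤
      (∑ i ∈ range (n + 1), expCoeff b i) * Real.exp (θ * ∑ j ∈ Icc 1 n, y ^ j / j) := by
    have hB : ∀ f : ℕ → ℝ, (∀ j, 0 ≤ f j) →
        truncNorm n (expSeries f) = ∑ i ∈ range (n + 1), expCoeff f i := fun f hf =>
      Finset.sum_congr rfl fun i _ => Real.norm_of_nonneg (expCoeff_nonneg hf i)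
    calc truncNorm n (expSeries fun j => u j - h j)
        ≤ ∑ i ∈ range (n + 1), expCoeff (fun j => b j + θ * y ^ j) i :=
          Finset.sum_le_sum fun i _ => norm_expCoeff_le hu i
      _ = truncNorm n (expSeries b * expSeries fun j => θ * y ^ j) := by
          rw [← expSeries_add, hB _ fun j => add_nonneg (hb j) (hy j)]
      _ ≤ _ := truncNorm_mul_le _ _ _
      _ ≤ _ := by
          rw [hB b hb, hB _ hy]
          refine mul_le_mul_of_nonneg_left ((sum_expCoeff_le_exp hy n).trans (le_of_eq ?_))
            (Finset.sum_nonneg fun i _ => expCoeff_nonneg hb i)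
          rw [Finset.mul_sum]
          congr 1
          exact Finset.sum_congr rfl fun j _ => by ring
  rw [hsplit, ← mul_assoc]
  calc _ ≤ _ := truncNorm_mul_le _ _ _
    _ ≤ _ := mul_le_mul h1 h2 (truncNorm_nonneg _ _) (by positivity)
    _ = _ := by rw [mul_add, Real.exp_add]; ring

/-- Multiplying z F' = (∑ u(j) z^j) F by 1 - z^l and reading off the coefficient of z^n gives n u_n
- (n - l) u_{n-l} on the left, u_i being the coefficients of F. -/
theorem natCast_mul_norm_sub_le {D : ℝ} {u : ℕ → ℂ} (hu : ∀ j, ‖u j‖ ≤ D) {l n : ℕ}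
    (hln : l ≤ n) :
    (n : ℝ) * ‖expCoeff u n - expCoeff u (n - l)‖ ≤ l * ‖expCoeff u (n - l)‖ +
      D * truncNorm n ((1 - PowerSeries.X ^ l) * expSeries u) := by
  have hD : 0 ≤ D := (norm_nonneg _).trans (hu 0)
  have hcoeff := coeff_symbolSeries_mul u ((1 - PowerSeries.X ^ l) * expSeries u) n
  rw [mul_left_comm, ← X_mul_derivative_expSeries, coeff_one_sub_X_pow_mul, if_pos hln,
    coeff_X_mul_derivative, coeff_X_mul_derivative, Nat.cast_sub hln] at hcoeff
  have heq : (n : ℂ) * (expCoeff u n - expCoeff u (n - l)) = -(l * expCoeff u (n - l)) +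
      ∑ j ∈ Icc 1 n, u j * PowerSeries.coeff (n - j) ((1 - PowerSeries.X ^ l) * expSeries u) := by
    rw [← hcoeff]
    simp only [expCoeff]
    ring
  have hnorm : (n : ℝ) * ‖expCoeff u n - expCoeff u (n - l)‖ =
      ‖(n : ℂ) * (expCoeff u n - expCoeff u (n - l))‖ := by simp
  rw [hnorm, heq]
  refine (norm_add_le _ _).trans (add_le_add (by simp) ?_)
  refine (norm_sum_le _ _).trans ?_
  rw [truncNorm, Finset.mul_sum]
  calc ∑ j ∈ Icc 1 n, ‖u j * PowerSeries.coeff (n - j) ((1 - PowerSeries.X ^ l) * expSeries u)‖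
      ≤ ∑ j ∈ Icc 1 n,
        D * ‖PowerSeries.coeff (n - j) ((1 - PowerSeries.X ^ l) * expSeries u)‖ := by
        refine Finset.sum_le_sum fun j _ => ?_
        rw [norm_mul]
        exact mul_le_mul_of_nonneg_right (hu j) (norm_nonneg _)
    _ = ∑ j ∈ range n,
        D * ‖PowerSeries.coeff j ((1 - PowerSeries.X ^ l) * expSeries u)‖ := by
        refine Finset.sum_bij' (fun j _ => n - j) (fun j _ => n - j) ?_ ?_ ?_ ?_ ?_
        · intro j hj; rw [mem_Icc] at hj; rw [mem_range]; omega
        · intro j hj; rw [mem_range] at hj; rw [mem_Icc]; omega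
        · intro j hj; rw [mem_Icc] at hj; omega
        · intro j hj; rw [mem_range] at hj; omega
        · intro j hj; rfl
    _ ≤ _ := by
        rw [Finset.sum_range_succ]
        have : 0 ≤ D * ‖PowerSeries.coeff n ((1 - PowerSeries.X ^ l) * expSeries u)‖ := by
          positivity
        linarith

end Smoothing

/-! ### Growth of coefficients and of their partial sums -/

theorem natCast_mul_expCoeff' {K : Type*} [Field K] [CharZero K] (a : ℕ → K) (n : ℕ) :
    (n : K) * expCoeff a n = ∑ i ∈ range n, a (n - i) * expCoeff a i := by
  rw [natCast_mul_expCoeff]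
  refine Finset.sum_bij' (fun j _ => n - j) (fun j _ => n - j) ?_ ?_ ?_ ?_ ?_
  · intro j hj; rw [mem_Icc] at hj; rw [mem_range]; omega
  · intro j hj; rw [mem_range] at hj; rw [mem_Icc]; omega
  · intro j hj; rw [mem_Icc] at hj; omega
  · intro j hj; rw [mem_range] at hj; omega
  · intro j hj
    rw [mem_Icc] at hj
    rw [show n - (n - j) = j by omega]

theorem sum_expCoeff_succ_le {b : ℕ → ℝ} {D : ℝ} (hb : ∀ j, 0 ≤ b j) (hbD : ∀ j, b j ≤ D)
    (n : ℕ) :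
    ∑ i ∈ range (n + 2), expCoeff b i ≤
      (1 + D / (n + 1)) * ∑ i ∈ range (n + 1), expCoeff b i := by
  have h : ((n + 1 : ℕ) : ℝ) * expCoeff b (n + 1) ≤ D * ∑ i ∈ range (n + 1), expCoeff b i := by
    rw [natCast_mul_expCoeff', Finset.mul_sum]
    exact Finset.sum_le_sum fun i _ => mul_le_mul_of_nonneg_right (hbD _) (expCoeff_nonneg hb i)
  have hn : (0 : ℝ) < n + 1 := by positivity
  push_cast at h
  rw [Finset.sum_range_succ, add_mul, one_mul, div_mul_eq_mul_div, add_le_add_iff_left,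
    le_div_iff₀ hn]
  linarith

theorem sum_expCoeff_add_le {b : ℕ → ℝ} {D : ℝ} (hb : ∀ j, 0 ≤ b j) (hbD : ∀ j, b j ≤ D)
    (m k : ℕ) :
    ∑ i ∈ range (m + k + 1), expCoeff b i ≤
      Real.exp (D * k / (m + 1)) * ∑ i ∈ range (m + 1), expCoeff b i := by
  have hD : 0 ≤ D := (hb 0).trans (hbD 0)
  have hS : ∀ n, 0 ≤ ∑ i ∈ range n, expCoeff b i := fun n =>
    Finset.sum_nonneg fun i _ => expCoeff_nonneg hb i
  induction k with
  | zero => simp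
  | succ k ih =>
    refine (sum_expCoeff_succ_le hb hbD (m + k)).trans ?_
    have h1 : 1 + D / ((m + k : ℕ) + 1) ≤ Real.exp (D / (m + 1)) := by
      refine le_trans ?_ (by simpa [add_comm] using Real.add_one_le_exp (D / ((m : ℝ) + 1)))
      push_cast
      gcongr
      linarith [k.cast_nonneg (α := ℝ)]
    calc _ ≤ Real.exp (D / (m + 1)) *
          (Real.exp (D * k / (m + 1)) * ∑ i ∈ range (m + 1), expCoeff b i) :=
        mul_le_mul h1 ih (hS _) (Real.exp_pos _).le
      _ = _ := by
        rw [← mul_assoc, ← Real.exp_add]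
        congr 2
        push_cast
        ring

/-- These are the coefficients of (1 - z)^(-θ-1); successive ratios are 1 + θ/(k + 1), and
Bernoulli's inequality compares them with those of (k + 1)^θ. -/
theorem rpow_le_expCoeff_const {θ : ℝ} (hθ0 : 0 ≤ θ) (hθ1 : θ ≤ 1) (k : ℕ) :
    ((k : ℝ) + 1) ^ θ ≤ expCoeff (fun _ => θ + 1) k := by
  induction k with
  | zero => simp [expCoeff_zero]
  | succ k ih =>
    have h1 := natCast_mul_expCoeff' (fun _ => θ + 1) (k + 1)
    have h2 := natCast_mul_expCoeff' (fun _ => θ + 1) k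
    rw [Finset.sum_range_succ, ← h2] at h1
    push_cast at h1 ⊢
    have hk : (0 : ℝ) < k + 1 := by positivity
    have h3 : expCoeff (fun _ => θ + 1) (k + 1) =
        (1 + θ * (1 / (k + 1))) * expCoeff (fun _ => θ + 1) k := by
      field_simp
      linarith
    rw [h3]
    have h4 : (k : ℝ) + 1 + 1 = (1 + 1 / (k + 1)) * (k + 1) := by field_simp
    rw [h4, Real.mul_rpow (by positivity) hk.le]
    refine mul_le_mul ?_ ih (by positivity) (by positivity)
    exact rpow_one_add_le_one_add_mul_self (by
      have : (0 : ℝ) ≤ 1 / (k + 1) := by positivity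
      linarith) hθ0 hθ1

/-- Partial sums of the `d` coefficients come from multiplying by 1/(1 - z), and d + 1 = (d - θ) +
(θ + 1). In this convolution the indices up to n/2 meet a weight of order n^θ, and doubling the
range of summation costs only the factor e^D. -/
theorem sum_expCoeff_sub_le {θ D : ℝ} {d : ℕ → ℝ} (hθ0 : 0 ≤ θ) (hθ1 : θ ≤ 1)
    (hd : ∀ j, θ ≤ d j) (hdD : ∀ j, d j ≤ D) {n : ℕ} (hn : 1 ≤ n) :
    (n : ℝ) ^ θ * ∑ i ∈ range (n + 1), expCoeff (fun j => d j - θ) i ≤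
      2 * Real.exp D * ∑ i ∈ range (n + 1), expCoeff d i := by
  have hb : ∀ j, 0 ≤ d j - θ := fun j => sub_nonneg.2 (hd j)
  have hbD : ∀ j, d j - θ ≤ D := fun j => by linarith [hdD j]
  have hD : 0 ≤ D := (hb 0).trans (hbD 0)
  have hE := expCoeff_nonneg hb
  obtain ⟨m, hm1, hm2⟩ : ∃ m, 2 * m ≤ n ∧ n ≤ 2 * m + 1 := ⟨n / 2, by omega, by omega⟩
  have hdouble : ∑ i ∈ range (n + 1), expCoeff (fun j => d j - θ) i ≤
      Real.exp D * ∑ i ∈ range (m + 1), expCoeff (fun j => d j - θ) i := by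
    have h := sum_expCoeff_add_le hb hbD m (n - m)
    rw [show m + (n - m) + 1 = n + 1 by omega] at h
    refine h.trans (mul_le_mul_of_nonneg_right ?_ (Finset.sum_nonneg fun i _ => hE i))
    rw [Real.exp_le_exp, mul_div_assoc]
    refine mul_le_of_le_one_right hD ((div_le_one (by positivity)).2 ?_)
    have : n - m ≤ m + 1 := by omega
    exact_mod_cast this
  have hlower : ((n : ℝ) / 2) ^ θ * ∑ i ∈ range (m + 1), expCoeff (fun j => d j - θ) i ≤
      ∑ i ∈ range (n + 1), expCoeff d i := by
    have hP : ∑ i ∈ range (n + 1), expCoeff d i = ∑ i ∈ range (n + 1),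
        expCoeff (fun j => d j - θ) i * expCoeff (fun _ => θ + 1) (n - i) := by
      rw [← expCoeff_add (fun j => d j - θ) (fun _ => θ + 1)]
      rw [show (fun j => d j - θ + (θ + 1)) = fun j => d j + 1 by ext j; ring,
        expCoeff_add d (fun _ => 1)]
      simp [expCoeff_one]
    rw [hP, Finset.mul_sum]
    calc _ ≤ ∑ i ∈ range (m + 1),
          expCoeff (fun j => d j - θ) i * expCoeff (fun _ => θ + 1) (n - i) := by
          refine Finset.sum_le_sum fun i hi => ?_
          rw [mem_range] at hi
          rw [mul_comm]
          refine mul_le_mul_of_nonneg_left ?_ (hE i)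
          refine le_trans ?_ (rpow_le_expCoeff_const hθ0 hθ1 (n - i))
          refine Real.rpow_le_rpow (by positivity) ?_ hθ0
          have : n ≤ 2 * (n - i) + 2 := by omega
          have h2 : (n : ℝ) ≤ 2 * ((n - i : ℕ) : ℝ) + 2 := by exact_mod_cast this
          linarith
      _ ≤ _ := by
          refine Finset.sum_le_sum_of_subset_of_nonneg ?_ fun i _ _ => ?_
          · intro x hx
            simp only [mem_range] at hx ⊢
            omega
          · exact mul_nonneg (hE i) (expCoeff_nonneg (fun _ => by linarith) _)
  have h2θ : (2 : ℝ) ^ θ ≤ 2 := by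
    simpa using Real.rpow_le_rpow_of_exponent_le (by norm_num : (1 : ℝ) ≤ 2) hθ1
  have hn2 : (n : ℝ) ^ θ = 2 ^ θ * ((n : ℝ) / 2) ^ θ := by
    rw [← Real.mul_rpow (by norm_num) (by positivity)]
    congr 1
    ring
  have hPn : 0 ≤ ∑ i ∈ range (n + 1), expCoeff d i :=
    Finset.sum_nonneg fun i _ => expCoeff_nonneg (fun j => hθ0.trans (hd j)) i
  calc _ ≤ (n : ℝ) ^ θ *
        (Real.exp D * ∑ i ∈ range (m + 1), expCoeff (fun j => d j - θ) i) :=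
        mul_le_mul_of_nonneg_left hdouble (by positivity)
    _ = 2 ^ θ * (Real.exp D * (((n : ℝ) / 2) ^ θ *
        ∑ i ∈ range (m + 1), expCoeff (fun j => d j - θ) i)) := by rw [hn2]; ring
    _ ≤ 2 * (Real.exp D * ∑ i ∈ range (n + 1), expCoeff d i) :=
        mul_le_mul h2θ (mul_le_mul_of_nonneg_left hlower (Real.exp_pos D).le)
          (mul_nonneg (Real.exp_pos D).le (mul_nonneg (by positivity)
            (Finset.sum_nonneg fun i _ => hE i))) (by norm_num)
    _ = _ := by ring

/-- In n p_n = ∑ d(n - i) p_i every weight is at least δ. -/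
theorem sum_expCoeff_le_mul {δ : ℝ} {d : ℕ → ℝ} (hδ : 0 < δ) (hd : ∀ j, δ ≤ d j) {n : ℕ}
    (hn : 1 ≤ n) :
    ∑ i ∈ range (n + 1), expCoeff d i ≤ (1 / δ + 1) * (n * expCoeff d n) := by
  have hE := expCoeff_nonneg fun j => hδ.le.trans (hd j)
  have h : δ * ∑ i ∈ range n, expCoeff d i ≤ n * expCoeff d n := by
    rw [natCast_mul_expCoeff', Finset.mul_sum]
    exact Finset.sum_le_sum fun i _ => mul_le_mul_of_nonneg_right (hd _) (hE i)
  have hn1 : (1 : ℝ) ≤ n := by exact_mod_cast hn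
  rw [Finset.sum_range_succ, add_mul, one_mul]
  refine add_le_add ?_ (le_mul_of_one_le_left (hE n) hn1)
  rw [one_div, inv_mul_eq_div, le_div_iff₀ hδ]
  linarith

theorem expCoeff_pos {d : ℕ → ℝ} (hd : ∀ j, 0 < d j) (n : ℕ) : 0 < expCoeff d n := by
  rcases Nat.eq_zero_or_pos n with rfl | hn
  · rw [expCoeff_zero]; exact zero_lt_one
  · have hn' : (0 : ℝ) < n := by exact_mod_cast hn
    refine pos_of_mul_pos_right (a := (n : ℝ)) ?_ hn'.le
    have hE := expCoeff_nonneg fun j => (hd j).le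
    rw [natCast_mul_expCoeff']
    refine Finset.sum_pos' (fun i _ => mul_nonneg (hd _).le (hE i))
      ⟨0, mem_range.2 hn, mul_pos (hd _) (by rw [expCoeff_zero]; exact zero_lt_one)⟩

/-- The exponent in the bound for the total variation of the coefficients. -/
noncomputable def variationExponent (n l : ℕ) (y : ℝ) : ℝ :=
  ∑ j ∈ Icc 1 (l - 1), (1 - y ^ j) / j + ∑ j ∈ Icc 1 n, y ^ j / j

theorem sum_one_div_le_one_add_log (n : ℕ) :
    ∑ j ∈ Icc 1 n, (1 : ℝ) / j ≤ 1 + Real.log n := by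
  have := harmonic_le_one_add_log n
  rw [harmonic_eq_sum_Icc] at this
  push_cast at this
  simpa only [one_div] using this

/-! ### Pointwise bounds for the variation exponent -/

section VariationExponent

variable {n l : ℕ} {y : ℝ}

theorem sum_pow_div_le_one_add_log (hy0 : 0 ≤ y) (hy1 : y ≤ 1) :
    ∑ j ∈ Icc 1 n, y ^ j / j ≤ 1 + Real.log n :=
  (Finset.sum_le_sum fun j _ => by gcongr; exact pow_le_one₀ hy0 hy1).trans
    (sum_one_div_le_one_add_log n)

theorem sum_pow_div_le_neg_log (hy0 : 0 ≤ y) (hy1 : y < 1) :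
    ∑ j ∈ Icc 1 n, y ^ j / j ≤ -Real.log (1 - y) := by
  have h := Real.hasSum_pow_div_log_of_abs_lt_one (abs_lt.2 ⟨by linarith, hy1⟩)
  have h2 := h.summable.sum_le_tsum (range n) fun i _ => by positivity
  rw [h.tsum_eq] at h2
  rw [show Icc 1 n = (range n).map (addRightEmbedding 1) by
      ext x; simp only [mem_Icc, mem_map, mem_range, addRightEmbedding_apply]
      exact ⟨fun h => ⟨x - 1, by omega, by omega⟩, by rintro ⟨y, hy, rfl⟩; omega⟩]
  simpa using h2

theorem sum_one_sub_pow_div_le (hy0 : 0 ≤ y) (hy1 : y ≤ 1) (h : (l : ℝ) * (1 - y) ≤ 1) :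
    ∑ j ∈ Icc 1 (l - 1), (1 - y ^ j) / j ≤ 1 := by
  calc ∑ j ∈ Icc 1 (l - 1), (1 - y ^ j) / (j : ℝ) ≤ ∑ j ∈ Icc 1 (l - 1), (1 - y) := by
        refine Finset.sum_le_sum fun j hj => ?_
        rw [mem_Icc] at hj
        have hj0 : (0 : ℝ) < j := by exact_mod_cast hj.1
        rw [div_le_iff₀ hj0]
        have := one_add_mul_le_pow (a := y - 1) (by linarith) j
        rw [show 1 + (y - 1) = y by ring] at this
        linarith
    _ = ((l - 1 : ℕ) : ℝ) * (1 - y) := by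
        rw [Finset.sum_const, Nat.card_Icc, nsmul_eq_mul, Nat.add_sub_cancel]
    _ ≤ l * (1 - y) := by
        refine mul_le_mul_of_nonneg_right ?_ (by linarith)
        exact_mod_cast Nat.sub_le l 1
    _ ≤ 1 := h

/-- Below `l` the two sums combine to a harmonic sum; from `l` on, the terms y^j / j are at most y^j
/ l, and the geometric tail is bounded by 1/(l(1 - y)) ≤ 1. -/
theorem variationExponent_le_of_one_le (hl : 1 ≤ l) (hy0 : 0 ≤ y) (hy1 : y < 1)
    (h : 1 ≤ (l : ℝ) * (1 - y)) : variationExponent n l y ≤ 2 + Real.log l := by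
  have hl0 : (0 : ℝ) < l := by exact_mod_cast hl
  have hy1' : 0 < 1 - y := by linarith
  have hsub : Icc 1 n ⊆ Icc 1 (l - 1) ∪ Ico l (l + n) := by
    intro j hj
    simp only [mem_Icc, mem_union, mem_Ico] at hj ⊢
    omega
  have hdisj : Disjoint (Icc 1 (l - 1)) (Ico l (l + n)) := by
    rw [Finset.disjoint_left]
    intro j hj hj'
    simp only [mem_Icc, mem_Ico] at hj hj'
    omega
  have h1 : ∑ j ∈ Icc 1 n, y ^ j / (j : ℝ) ≤
      ∑ j ∈ Icc 1 (l - 1), y ^ j / (j : ℝ) + ∑ j ∈ Ico l (l + n), y ^ j / (j : ℝ) := by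
    rw [← Finset.sum_union hdisj]
    exact Finset.sum_le_sum_of_subset_of_nonneg hsub fun j _ _ => by positivity
  have h2 : ∑ j ∈ Ico l (l + n), y ^ j / (j : ℝ) ≤ 1 := by
    calc ∑ j ∈ Ico l (l + n), y ^ j / (j : ℝ) ≤ ∑ j ∈ Ico l (l + n), y ^ j / (l : ℝ) := by
          refine Finset.sum_le_sum fun j hj => ?_
          rw [mem_Ico] at hj
          have : (l : ℝ) ≤ j := by exact_mod_cast hj.1
          gcongr
      _ = (∑ j ∈ Ico l (l + n), y ^ j) / l := by rw [Finset.sum_div]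
      _ ≤ (1 - y)⁻¹ / l := by
          gcongr
          refine (Finset.sum_le_sum_of_subset_of_nonneg (t := range (l + n)) ?_
            fun _ _ _ => by positivity).trans ?_
          · intro x hx
            simp only [mem_Ico, mem_range] at hx ⊢
            omega
          · rw [← tsum_geometric_of_lt_one hy0 hy1]
            exact (summable_geometric_of_lt_one hy0 hy1).sum_le_tsum _ fun _ _ => by positivity
      _ ≤ 1 := by
          rw [div_le_one hl0, inv_le_comm₀ hy1' hl0, inv_le_iff_one_le_mul₀ hl0]
          linarith
  have h3 : ∑ j ∈ Icc 1 (l - 1), (1 - y ^ j) / (j : ℝ) + ∑ j ∈ Icc 1 (l - 1), y ^ j / (j : ℝ) =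
      ∑ j ∈ Icc 1 (l - 1), (1 : ℝ) / j := by
    rw [← Finset.sum_add_distrib]
    exact Finset.sum_congr rfl fun j _ => by ring
  have h4 : ∑ j ∈ Icc 1 (l - 1), (1 : ℝ) / j ≤ 1 + Real.log l := by
    refine le_trans ?_ (sum_one_div_le_one_add_log l)
    refine Finset.sum_le_sum_of_subset_of_nonneg ?_ fun _ _ _ => by positivity
    intro x hx
    simp only [mem_Icc] at hx ⊢
    omega
  unfold variationExponent
  linarith

theorem exp_mul_variationExponent_le_of_one_le {θ : ℝ} (hθ0 : 0 ≤ θ) (hθ1 : θ ≤ 1) (hl : 1 ≤ l)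
    (hy0 : 0 ≤ y) (hy1 : y < 1) (h : 1 ≤ (l : ℝ) * (1 - y)) :
    Real.exp (θ * variationExponent n l y) ≤ Real.exp 2 * (l : ℝ) ^ θ := by
  have hl0 : (0 : ℝ) < l := by exact_mod_cast hl
  rw [Real.rpow_def_of_pos hl0, ← Real.exp_add, Real.exp_le_exp]
  have := mul_le_mul_of_nonneg_left (variationExponent_le_of_one_le (n := n) hl hy0 hy1 h) hθ0
  linarith

theorem exp_mul_variationExponent_le_of_le_one {θ : ℝ} (hθ0 : 0 ≤ θ) (hθ1 : θ ≤ 1)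
    (hy0 : 0 ≤ y) (hy1 : y < 1) (h : (l : ℝ) * (1 - y) ≤ 1) :
    Real.exp (θ * variationExponent n l y) ≤ Real.exp 2 * (1 - y) ^ (-θ) := by
  rw [Real.rpow_def_of_pos (by linarith), ← Real.exp_add, Real.exp_le_exp]
  have := mul_le_mul_of_nonneg_left (add_le_add (sum_one_sub_pow_div_le hy0 hy1.le h)
    (sum_pow_div_le_neg_log (n := n) hy0 hy1)) hθ0
  unfold variationExponent
  linarith

theorem exp_variationExponent_le (hn : 1 ≤ n)
    (hy0 : 0 ≤ y) (hy1 : y ≤ 1) (h : (l : ℝ) * (1 - y) ≤ 1) :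
    Real.exp (variationExponent n l y) ≤ Real.exp 2 * n := by
  have hn0 : (0 : ℝ) < n := by exact_mod_cast hn
  rw [← Real.exp_log hn0, ← Real.exp_add, Real.exp_le_exp]
  have := add_le_add (sum_one_sub_pow_div_le hy0 hy1 h)
    (sum_pow_div_le_one_add_log (n := n) hy0 hy1)
  unfold variationExponent
  linarith

@[fun_prop]
theorem continuous_variationExponent (n l : ℕ) : Continuous (variationExponent n l) := by
  unfold variationExponent
  fun_prop

end VariationExponent

/-! ### Integration over the interpolation parameter -/

section VariationIntegral

variable {n l : ℕ}

/-- The integral of the bound for the total variation of the coefficients. -/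
noncomputable def variationIntegral (θ : ℝ) (n l : ℕ) : ℝ :=
  ∫ y in (0 : ℝ)..1, y ^ (l - 1) * Real.exp (θ * variationExponent n l y)

theorem intervalIntegrable_variation (θ : ℝ) (n l : ℕ) (a b : ℝ) :
    IntervalIntegrable (fun y => y ^ (l - 1) * Real.exp (θ * variationExponent n l y))
      MeasureTheory.volume a b :=
  Continuous.intervalIntegrable (by fun_prop) a b

theorem integral_variation_left_le {θ : ℝ} (hθ0 : 0 ≤ θ) (hθ1 : θ ≤ 1) (hl : 1 ≤ l) :
    ∫ y in (0 : ℝ)..(1 - 1 / l), y ^ (l - 1) * Real.exp (θ * variationExponent n l y) ≤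
      Real.exp 2 * ((l : ℝ) ^ θ / l) := by
  have hl0 : (0 : ℝ) < l := by exact_mod_cast hl
  have hl1 : (1 : ℝ) / l ≤ 1 := (div_le_one hl0).2 (by exact_mod_cast hl)
  have hl2 : (0 : ℝ) < 1 / l := by positivity
  calc _ ≤ ∫ y in (0 : ℝ)..(1 - 1 / l), y ^ (l - 1) * (Real.exp 2 * (l : ℝ) ^ θ) := by
        refine intervalIntegral.integral_mono_on (by linarith)
          (intervalIntegrable_variation _ _ _ _ _)
          (Continuous.intervalIntegrable (by fun_prop) _ _) fun y hy => ?_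
        refine mul_le_mul_of_nonneg_left ?_ (pow_nonneg hy.1 _)
        refine exp_mul_variationExponent_le_of_one_le hθ0 hθ1 hl hy.1 (by linarith [hy.2]) ?_
        have h1 : 1 / (l : ℝ) ≤ 1 - y := by linarith [hy.2]
        rw [div_le_iff₀ hl0] at h1
        linarith
    _ = (1 - 1 / (l : ℝ)) ^ l / l * (Real.exp 2 * (l : ℝ) ^ θ) := by
        rw [intervalIntegral.integral_mul_const, integral_pow, Nat.sub_add_cancel hl,
          zero_pow (by omega), sub_zero, Nat.cast_sub hl]
        simp
    _ ≤ 1 / l * (Real.exp 2 * (l : ℝ) ^ θ) := by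
        gcongr
        exact pow_le_one₀ (by linarith) (by linarith)
    _ = _ := by ring

theorem natCast_mul_one_sub_le (hl : 1 ≤ l) {y : ℝ} (hy : 1 - 1 / (l : ℝ) ≤ y) :
    (l : ℝ) * (1 - y) ≤ 1 := by
  have hl0 : (0 : ℝ) < l := by exact_mod_cast hl
  have h1 : 1 - y ≤ 1 / (l : ℝ) := by linarith
  rw [le_div_iff₀ hl0] at h1
  linarith

/-- The range is cut at 1 - 1/l, where the two pointwise bounds l^θ and (1 - y)^(-θ) agree; the
latter is integrable up to 1 because θ < 1. -/
theorem variationIntegral_le {θ : ℝ} (hθ0 : 0 ≤ θ) (hθ1 : θ < 1) (hl : 1 ≤ l) :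
    variationIntegral θ n l ≤ Real.exp 2 * (1 + 1 / (1 - θ)) * (l : ℝ) ^ (θ - 1) := by
  have hl0 : (0 : ℝ) < l := by exact_mod_cast hl
  have hl1 : (1 : ℝ) / l ≤ 1 := (div_le_one hl0).2 (by exact_mod_cast hl)
  have hl2 : (0 : ℝ) < 1 / l := by positivity
  have hright : ∫ y in (1 - 1 / (l : ℝ))..1,
      y ^ (l - 1) * Real.exp (θ * variationExponent n l y) ≤
        Real.exp 2 * ((l : ℝ) ^ (θ - 1) / (1 - θ)) := by
    have hint : IntervalIntegrable (fun y : ℝ => (1 - y) ^ (-θ)) MeasureTheory.volume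
        (1 - 1 / (l : ℝ)) 1 := by
      have := (intervalIntegral.intervalIntegrable_rpow' (r := -θ) (by linarith)
        (a := 1 / (l : ℝ)) (b := 0)).comp_sub_left 1
      simpa using this
    calc _ ≤ ∫ y in (1 - 1 / (l : ℝ))..1, Real.exp 2 * (1 - y) ^ (-θ) := by
          refine intervalIntegral.integral_mono_on_of_le_Ioo (by linarith)
            (intervalIntegrable_variation _ _ _ _ _) (hint.const_mul _) fun y hy => ?_
          have hy0 : 0 ≤ y := by linarith [hy.1]
          refine (mul_le_of_le_one_left (Real.exp_pos _).le (pow_le_one₀ hy0 hy.2.le)).trans ?_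
          exact exp_mul_variationExponent_le_of_le_one hθ0 hθ1.le hy0 hy.2
            (natCast_mul_one_sub_le hl hy.1.le)
      _ = _ := by
          rw [intervalIntegral.integral_const_mul,
            intervalIntegral.integral_comp_sub_left (fun x => x ^ (-θ)) 1, sub_self,
            sub_sub_cancel, integral_rpow (Or.inl (by linarith)),
            Real.zero_rpow (by linarith), sub_zero, one_div,
            Real.inv_rpow hl0.le, ← Real.rpow_neg hl0.le]
          rw [show -(-θ + 1) = θ - 1 by ring, show -θ + 1 = 1 - θ by ring]
  have hleft := integral_variation_left_le (n := n) hθ0 hθ1.le hl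
  rw [← Real.rpow_sub_one hl0.ne'] at hleft
  rw [variationIntegral, ← intervalIntegral.integral_add_adjacent_intervals
    (intervalIntegrable_variation θ n l 0 (1 - 1 / l)) (intervalIntegrable_variation θ n l _ 1)]
  calc _ ≤ _ := add_le_add hleft hright
    _ = _ := by ring

/-- For θ = 1 the bound 1/(1 - y) is not integrable at 1, so a second cut at 1 - 1/n is made: the
middle range yields log(n/l), and the last one, of length 1/n, uses the uniform bound e² n. -/
theorem variationIntegral_one_le (hl : 1 ≤ l) (hln : l ≤ n) :
    variationIntegral 1 n l ≤ 2 * Real.exp 2 * (1 + Real.log (n / l)) := by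
  have hl0 : (0 : ℝ) < l := by exact_mod_cast hl
  have hn0 : (0 : ℝ) < n := by exact_mod_cast hl.trans hln
  have hl1 : (1 : ℝ) / l ≤ 1 := (div_le_one hl0).2 (by exact_mod_cast hl)
  have hnl : (1 : ℝ) / n ≤ 1 / l := one_div_le_one_div_of_le hl0 (by exact_mod_cast hln)
  have hn2 : (0 : ℝ) < 1 / n := by positivity
  have hmid : ∫ y in (1 - 1 / (l : ℝ))..(1 - 1 / n),
      y ^ (l - 1) * Real.exp (1 * variationExponent n l y) ≤
        Real.exp 2 * Real.log (n / l) := by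
    have hint : IntervalIntegrable (fun y : ℝ => (1 - y)⁻¹) MeasureTheory.volume
        (1 - 1 / (l : ℝ)) (1 - 1 / n) := by
      refine ContinuousOn.intervalIntegrable (ContinuousOn.inv₀ (by fun_prop) fun y hy => ?_)
      rw [Set.uIcc_of_le (by linarith)] at hy
      linarith [hy.2]
    calc _ ≤ ∫ y in (1 - 1 / (l : ℝ))..(1 - 1 / n), Real.exp 2 * (1 - y)⁻¹ := by
          refine intervalIntegral.integral_mono_on (by linarith)
            (intervalIntegrable_variation _ _ _ _ _) (hint.const_mul _) fun y hy => ?_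
          have hy0 : 0 ≤ y := by linarith [hy.1]
          have hy1 : y < 1 := by linarith [hy.2]
          refine (mul_le_of_le_one_left (Real.exp_pos _).le (pow_le_one₀ hy0 hy1.le)).trans ?_
          rw [← Real.rpow_neg_one]
          exact exp_mul_variationExponent_le_of_le_one zero_le_one le_rfl hy0 hy1
            (natCast_mul_one_sub_le hl hy.1)
      _ = _ := by
          rw [intervalIntegral.integral_const_mul,
            intervalIntegral.integral_comp_sub_left (fun x => x⁻¹) 1, sub_sub_cancel,
            sub_sub_cancel, integral_inv_of_pos hn2 (by positivity)]
          congr 2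
          field_simp
  have hright : ∫ y in (1 - 1 / (n : ℝ))..1,
      y ^ (l - 1) * Real.exp (1 * variationExponent n l y) ≤ Real.exp 2 := by
    calc _ ≤ ∫ y in (1 - 1 / (n : ℝ))..1, Real.exp 2 * n := by
          refine intervalIntegral.integral_mono_on (by linarith)
            (intervalIntegrable_variation _ _ _ _ _)
            (Continuous.intervalIntegrable (by fun_prop) _ _) fun y hy => ?_
          have hy0 : 0 ≤ y := by linarith [hy.1]
          refine (mul_le_of_le_one_left (Real.exp_pos _).le (pow_le_one₀ hy0 hy.2)).trans ?_
          rw [one_mul]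
          exact exp_variationExponent_le (hl.trans hln) hy0 hy.2
            (natCast_mul_one_sub_le hl (by linarith [hy.1]))
      _ = _ := by
          rw [intervalIntegral.integral_const, smul_eq_mul]
          field_simp
          ring
  have hleft := integral_variation_left_le (n := n) zero_le_one le_rfl hl
  rw [Real.rpow_one, div_self hl0.ne', mul_one] at hleft
  have hlog : 0 ≤ Real.log (n / l) :=
    Real.log_nonneg ((one_le_div hl0).2 (by exact_mod_cast hln))
  rw [variationIntegral, ← intervalIntegral.integral_add_adjacent_intervals
    (intervalIntegrable_variation 1 n l 0 (1 - 1 / l)) (intervalIntegrable_variation 1 n l _ 1),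
    ← intervalIntegral.integral_add_adjacent_intervals
    (intervalIntegrable_variation 1 n l (1 - 1 / l) (1 - 1 / n))
    (intervalIntegrable_variation 1 n l _ 1)]
  nlinarith [mul_nonneg (Real.exp_pos 2).le hlog]

end VariationIntegral

/-! ### The interpolating path and its derivative -/

section Interpolation

theorem hasDerivAt_ofReal_pow (k : ℕ) (y : ℝ) :
    HasDerivAt (fun y : ℝ => (y : ℂ) ^ k) (k * (y : ℂ) ^ (k - 1)) y :=
  (hasDerivAt_pow k (y : ℂ)).comp_ofReal

theorem expCoeff_mul_pow_add (a b : ℕ → ℂ) (n : ℕ) (y : ℂ) :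
    expCoeff (fun j => a j * y ^ j + b j) n =
      ∑ k ∈ range (n + 1), expCoeff a k * y ^ k * expCoeff b (n - k) := by
  rw [expCoeff_add (fun j => a j * y ^ j) b]
  simp only [expCoeff_mul_pow]

/-- On the factor with exponents a(j) y^j the operators y d/dy and z d/dz coincide, so the
derivative follows from the differential equation in z after division by `y`. -/
theorem hasDerivAt_expCoeff_mul_pow_add (a b : ℕ → ℂ) (n : ℕ) {y : ℝ} (hy : y ≠ 0) :
    HasDerivAt (fun y : ℝ => expCoeff (fun j => a j * (y : ℂ) ^ j + b j) n)
      (∑ l ∈ Icc 1 n, a l * (y : ℂ) ^ (l - 1) *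
        expCoeff (fun j => a j * (y : ℂ) ^ j + b j) (n - l)) y := by
  have hy' : (y : ℂ) ≠ 0 := by exact_mod_cast hy
  have hd : HasDerivAt (fun y : ℝ => expCoeff (fun j => a j * (y : ℂ) ^ j + b j) n)
      (∑ k ∈ range (n + 1),
        expCoeff a k * (k * (y : ℂ) ^ (k - 1)) * expCoeff b (n - k)) y := by
    simp only [expCoeff_mul_pow_add]
    exact HasDerivAt.fun_sum fun k _ =>
      ((hasDerivAt_ofReal_pow k y).const_mul _).mul_const _
  convert hd using 1
  apply mul_left_cancel₀ hy'
  have h := coeff_symbolSeries_mul (fun j => a j * (y : ℂ) ^ j)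
    (expSeries fun j => a j * (y : ℂ) ^ j + b j) n
  rw [expSeries_add (fun j => a j * (y : ℂ) ^ j), ← mul_assoc, ← X_mul_derivative_expSeries,
    PowerSeries.coeff_mul, Nat.sum_antidiagonal_eq_sum_range_succ_mk,
    ← expSeries_add (fun j => a j * (y : ℂ) ^ j)] at h
  simp only [coeff_X_mul_derivative] at h
  rw [Finset.mul_sum, Finset.mul_sum]
  calc _ = ∑ l ∈ Icc 1 n, a l * (y : ℂ) ^ l *
        expCoeff (fun j => a j * (y : ℂ) ^ j + b j) (n - l) := by
        refine Finset.sum_congr rfl fun l hl => ?_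
        rw [mem_Icc] at hl
        rw [← mul_pow_sub_one (show l ≠ 0 by omega) (y : ℂ)]
        ring
    _ = _ := h.symm
    _ = _ := by
        refine Finset.sum_congr rfl fun k _ => ?_
        change (k : ℂ) * expCoeff (fun j => a j * (y : ℂ) ^ j) k * expCoeff b (n - k) = _
        rw [expCoeff_mul_pow]
        rcases Nat.eq_zero_or_pos k with rfl | hk
        · simp
        · rw [← mul_pow_sub_one hk.ne' (y : ℂ)]
          ring

variable {d : ℕ → ℝ} {f : ℕ → ℂ}

theorem norm_interpolation_le (hd : ∀ j, 0 ≤ d j) (hf : ∀ j, ‖f j‖ ≤ 1) {y : ℝ} (hy0 : 0 ≤ y)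
    (hy1 : y ≤ 1) (j : ℕ) : ‖(d j : ℂ) * (f j - 1) * (y : ℂ) ^ j + d j‖ ≤ d j := by
  have hyj : 0 ≤ y ^ j := pow_nonneg hy0 j
  have hyj1 : y ^ j ≤ 1 := pow_le_one₀ hy0 hy1
  have h : (d j : ℂ) * (f j - 1) * (y : ℂ) ^ j + d j =
      ((d j * (1 - y ^ j) : ℝ) : ℂ) + ((d j * y ^ j : ℝ) : ℂ) * f j := by
    push_cast
    ring
  rw [h]
  refine (norm_add_le _ _).trans ?_
  rw [norm_mul, Complex.norm_real, Complex.norm_real,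
    Real.norm_of_nonneg (mul_nonneg (hd j) (by linarith)),
    Real.norm_of_nonneg (mul_nonneg (hd j) hyj)]
  have := mul_le_of_le_one_right (mul_nonneg (hd j) hyj) (hf j)
  linarith

/-- The difference equals (d - θ)(1 - y^j) + d y^j f(j), where both real coefficients are
nonnegative because θ ≤ d. -/
theorem norm_interpolation_sub_le {θ : ℝ} (hθ0 : 0 ≤ θ) (hd : ∀ j, θ ≤ d j)
    (hf : ∀ j, ‖f j‖ ≤ 1) {y : ℝ} (hy0 : 0 ≤ y) (hy1 : y ≤ 1) (j : ℕ) :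
    ‖(d j : ℂ) * (f j - 1) * (y : ℂ) ^ j + d j - ((θ * (1 - y ^ j) : ℝ) : ℂ)‖ ≤
      d j - θ + θ * y ^ j := by
  have hyj : 0 ≤ y ^ j := pow_nonneg hy0 j
  have hyj1 : y ^ j ≤ 1 := pow_le_one₀ hy0 hy1
  have hd0 : 0 ≤ d j := hθ0.trans (hd j)
  have h : (d j : ℂ) * (f j - 1) * (y : ℂ) ^ j + d j - ((θ * (1 - y ^ j) : ℝ) : ℂ) =
      (((d j - θ) * (1 - y ^ j) : ℝ) : ℂ) + ((d j * y ^ j : ℝ) : ℂ) * f j := by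
    push_cast
    ring
  rw [h]
  refine (norm_add_le _ _).trans ?_
  rw [norm_mul, Complex.norm_real, Complex.norm_real,
    Real.norm_of_nonneg (mul_nonneg (by linarith [hd j]) (by linarith)),
    Real.norm_of_nonneg (mul_nonneg hd0 hyj)]
  have := mul_le_of_le_one_right (mul_nonneg hd0 hyj) (hf j)
  linarith

theorem norm_expCoeff_interpolation_sub_le {θ D : ℝ} (hθ0 : 0 ≤ θ) (hθ1 : θ ≤ 1)
    (hd : ∀ j, θ ≤ d j) (hdD : ∀ j, d j ≤ D) (hf : ∀ j, ‖f j‖ ≤ 1) {n l : ℕ} (hl : 1 ≤ l)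
    (hln : l ≤ n) {y : ℝ} (hy0 : 0 < y) (hy1 : y ≤ 1) :
    ‖expCoeff (fun j => (d j : ℂ) * (f j - 1) * (y : ℂ) ^ j + d j) (n - l) -
        expCoeff (fun j => (d j : ℂ) * (f j - 1) * (y : ℂ) ^ j + d j) n‖ ≤
      (l * expCoeff d (n - l) + 2 * D * (∑ i ∈ range (n + 1), expCoeff (fun j => d j - θ) i) *
        Real.exp (θ * variationExponent n l y)) / n := by
  have hn0 : (0 : ℝ) < n := by exact_mod_cast hl.trans hln
  have hd0 : ∀ j, 0 ≤ d j := fun j => hθ0.trans (hd j)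
  have hu := norm_interpolation_le hd0 hf hy0.le hy1
  have h1 := natCast_mul_norm_sub_le (fun j => (hu j).trans (hdD j)) hln
  have h2 := truncNorm_one_sub_X_pow_mul_le hθ0 hθ1 hy0 hy1 (fun j => sub_nonneg.2 (hd j))
    (norm_interpolation_sub_le hθ0 hd hf hy0.le hy1) hl hln
  have h3 := mul_le_mul_of_nonneg_left (norm_expCoeff_le hu (n - l)) (l.cast_nonneg (α := ℝ))
  have h4 := mul_le_mul_of_nonneg_left h2 ((hd0 0).trans (hdD 0))
  rw [norm_sub_rev, le_div_iff₀ hn0]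
  unfold variationExponent
  linarith

/-- The logarithm of the limit value, with the variable scaled by `y`. -/
noncomputable def scaledLog (d : ℕ → ℝ) (f : ℕ → ℂ) (n : ℕ) (y : ℝ) : ℂ :=
  ∑ l ∈ Icc 1 n, (d l : ℂ) * (f l - 1) / l * (y : ℂ) ^ l

theorem hasDerivAt_scaledLog (n : ℕ) (y : ℝ) :
    HasDerivAt (scaledLog d f n)
      (∑ l ∈ Icc 1 n, (d l : ℂ) * (f l - 1) * (y : ℂ) ^ (l - 1)) y := by
  have h : HasDerivAt (scaledLog d f n)
      (∑ l ∈ Icc 1 n, (d l : ℂ) * (f l - 1) / l * (l * (y : ℂ) ^ (l - 1))) y :=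
    HasDerivAt.fun_sum fun l _ => (hasDerivAt_ofReal_pow l y).const_mul _
  convert h using 1
  refine Finset.sum_congr rfl fun l hl => ?_
  have : (l : ℂ) ≠ 0 := by
    rw [mem_Icc] at hl
    exact_mod_cast (show l ≠ 0 by omega)
  field_simp

theorem norm_exp_scaledLog_sub_le (hd : ∀ j, 0 ≤ d j) (hf : ∀ j, ‖f j‖ ≤ 1) (n : ℕ) {y : ℝ}
    (hy0 : 0 ≤ y) (hy1 : y ≤ 1) :
    ‖Complex.exp (scaledLog d f n 1 - scaledLog d f n y)‖ ≤ 1 := by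
  rw [Complex.norm_exp, Real.exp_le_one_iff, scaledLog, scaledLog, ← Finset.sum_sub_distrib,
    Complex.re_sum]
  refine Finset.sum_nonpos fun l _ => ?_
  have h : (d l : ℂ) * (f l - 1) / l * ((1 : ℝ) : ℂ) ^ l - (d l : ℂ) * (f l - 1) / l * (y : ℂ) ^ l =
      ((d l / l * (1 - y ^ l) : ℝ) : ℂ) * (f l - 1) := by
    push_cast
    ring
  rw [h, Complex.re_ofReal_mul]
  refine mul_nonpos_of_nonneg_of_nonpos ?_ ?_
  · have := pow_le_one₀ (n := l) hy0 hy1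
    exact mul_nonneg (div_nonneg (hd l) (by positivity)) (by linarith)
  · have := (Complex.re_le_norm (f l)).trans (hf l)
    simpa using this

theorem norm_expCoeff_sub_exp_le {θ D : ℝ} (hθ0 : 0 ≤ θ) (hθ1 : θ ≤ 1)
    (hd : ∀ j, θ ≤ d j) (hdD : ∀ j, d j ≤ D) (hf : ∀ j, ‖f j‖ ≤ 1) (n : ℕ) :
    ‖expCoeff (fun j => (d j : ℂ) * f j) n -
        (expCoeff d n : ℝ) * Complex.exp (∑ j ∈ Icc 1 n, (d j : ℂ) * ((f j - 1) / (j : ℂ)))‖ ≤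
      ∑ l ∈ Icc 1 n, D * ‖f l - 1‖ * ((expCoeff d (n - l) +
        2 * D * (∑ i ∈ range (n + 1), expCoeff (fun j => d j - θ) i) *
          variationIntegral θ n l) / n) := by
  have hd0 : ∀ j, 0 ≤ d j := fun j => hθ0.trans (hd j)
  set S := ∑ i ∈ range (n + 1), expCoeff (fun j => d j - θ) i with hS
  set U : ℕ → ℝ → ℂ := fun i y =>
    expCoeff (fun j => (d j : ℂ) * (f j - 1) * (y : ℂ) ^ j + d j) i with hU
  set Φ : ℝ → ℂ := fun y => U n y * Complex.exp (scaledLog d f n 1 - scaledLog d f n y) with hΦ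
  -- The factor l y^(l-1) integrates to 1, so the weight l disappears from the p_{n-l} term after
  -- integration.
  set B : ℝ → ℝ := fun y => ∑ l ∈ Icc 1 n, D * ‖f l - 1‖ *
    ((expCoeff d (n - l) * (l * y ^ (l - 1)) +
      2 * D * S * (y ^ (l - 1) * Real.exp (θ * variationExponent n l y))) / n) with hB
  have hcontU : Continuous (U n) := by
    rw [hU]
    simp only [expCoeff_mul_pow_add]
    fun_prop
  have hcontΦ : Continuous Φ := by
    have : Continuous (scaledLog d f n) :=
      continuous_iff_continuousAt.2 fun y => (hasDerivAt_scaledLog n y).continuousAt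
    fun_prop
  -- The exponential factor contributes -L'(y) U_n(y), which turns each U_{n-l} in the derivative of
  -- U_n into a difference.
  have hderiv : ∀ y ∈ Set.Ioo (0 : ℝ) 1, HasDerivAt Φ
      (Complex.exp (scaledLog d f n 1 - scaledLog d f n y) *
        ∑ l ∈ Icc 1 n, (d l : ℂ) * (f l - 1) * (y : ℂ) ^ (l - 1) * (U (n - l) y - U n y)) y := by
    intro y hy
    have h1 := hasDerivAt_expCoeff_mul_pow_add (fun j => (d j : ℂ) * (f j - 1))
      (fun j => (d j : ℂ)) n hy.1.ne'
    have h2 := ((hasDerivAt_scaledLog (d := d) (f := f) n y).const_sub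
      (scaledLog d f n 1)).cexp
    refine (h1.mul h2).congr_deriv ?_
    simp only [hU]
    simp only [mul_sub, Finset.sum_sub_distrib, ← Finset.sum_mul]
    ring
  have hbound : ∀ y ∈ Set.Ioo (0 : ℝ) 1, ‖deriv Φ y‖ ≤ B y := by
    intro y hy
    rw [(hderiv y hy).deriv, norm_mul]
    refine (mul_le_of_le_one_left (norm_nonneg _)
      (norm_exp_scaledLog_sub_le hd0 hf n hy.1.le hy.2.le)).trans ?_
    refine (norm_sum_le _ _).trans (Finset.sum_le_sum fun l hl => ?_)
    rw [mem_Icc] at hl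
    have h := norm_expCoeff_interpolation_sub_le hθ0 hθ1 hd hdD hf hl.1 hl.2 hy.1 hy.2.le
    rw [norm_mul, norm_mul, norm_mul, norm_pow, Complex.norm_real, Complex.norm_real,
      Real.norm_of_nonneg (hd0 l), Real.norm_of_nonneg hy.1.le]
    have hy' : 0 ≤ y ^ (l - 1) := pow_nonneg hy.1.le _
    calc _ ≤ D * ‖f l - 1‖ * y ^ (l - 1) * _ := by
          refine mul_le_mul ?_ h (norm_nonneg _)
            (mul_nonneg (mul_nonneg ((hd0 l).trans (hdD l)) (norm_nonneg _)) hy')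
          gcongr
          exact hdD l
      _ = _ := by ring
  have hBint : IntervalIntegrable B MeasureTheory.volume 0 1 :=
    Continuous.intervalIntegrable (by fun_prop) _ _
  have hmain := norm_sub_le_integral_of_norm_deriv_le_of_le zero_le_one
    hcontΦ.continuousOn
    (fun y hy => (hderiv y hy).differentiableAt.differentiableWithinAt)
    (Filter.Eventually.of_forall hbound) hBint
  have hΦ1 : Φ 1 = expCoeff (fun j => (d j : ℂ) * f j) n := by
    simp only [hΦ, hU, sub_self, Complex.exp_zero, mul_one]
    congr 1
    ext j
    push_cast
    ring
  have hlog0 : scaledLog d f n 0 = 0 := by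
    refine Finset.sum_eq_zero fun l hl => ?_
    rw [mem_Icc] at hl
    rw [Complex.ofReal_zero, zero_pow (by omega), mul_zero]
  have hlog1 : scaledLog d f n 1 = ∑ j ∈ Icc 1 n, (d j : ℂ) * ((f j - 1) / (j : ℂ)) := by
    refine Finset.sum_congr rfl fun l _ => ?_
    push_cast
    ring
  have hΦ0 : Φ 0 = (expCoeff d n : ℝ) *
      Complex.exp (∑ j ∈ Icc 1 n, (d j : ℂ) * ((f j - 1) / (j : ℂ))) := by
    have h : U n 0 = (expCoeff d n : ℝ) := by
      refine Eq.trans (expCoeff_congr fun j hj => ?_) (map_expCoeff Complex.ofRealHom d n).symm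
      rw [mem_Icc] at hj
      rw [Complex.ofReal_zero, zero_pow (by omega), mul_zero, zero_add]
      rfl
    simp only [hΦ]
    rw [h, hlog0, sub_zero, hlog1]
  have hBval : ∫ y in (0 : ℝ)..1, B y = ∑ l ∈ Icc 1 n, D * ‖f l - 1‖ * ((expCoeff d (n - l) +
      2 * D * S * variationIntegral θ n l) / n) := by
    rw [hB, intervalIntegral.integral_finsetSum fun l _ =>
      Continuous.intervalIntegrable (by fun_prop) _ _]
    refine Finset.sum_congr rfl fun l hl => ?_
    rw [mem_Icc] at hl
    have hl0 : (l : ℝ) ≠ 0 := by exact_mod_cast (show l ≠ 0 by omega)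
    rw [intervalIntegral.integral_const_mul, intervalIntegral.integral_div,
      intervalIntegral.integral_add (Continuous.intervalIntegrable (by fun_prop) _ _)
        ((intervalIntegrable_variation θ n l 0 1).const_mul _),
      intervalIntegral.integral_const_mul, intervalIntegral.integral_const_mul,
      intervalIntegral.integral_const_mul, integral_pow, Nat.sub_add_cancel hl.1,
      Nat.cast_sub hl.1, variationIntegral, one_pow, zero_pow (by omega), Nat.cast_one,
      sub_add_cancel, sub_zero, mul_one_div_cancel hl0, mul_one]
  rw [← hΦ1, ← hΦ0, ← hBval]
  exact hmain

end Interpolation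

/-! ### Normalization by p_n and the final constants -/

theorem norm_div_sub_eq {p : ℝ} (hp : 0 < p) {a e : ℂ} : ‖a / p - e‖ = ‖a - p * e‖ / p := by
  have hp' : (p : ℂ) ≠ 0 := by exact_mod_cast hp.ne'
  have h : a / p - e = (a - p * e) / p := by field_simp
  rw [h, norm_div, Complex.norm_real, Real.norm_of_nonneg hp.le]

theorem meanError_le {δ θ D W : ℝ} (hδ : 0 < δ) (hθ0 : 0 ≤ θ) (hθ1 : θ ≤ 1) (hθδ : θ ≤ δ)
    (hD : 0 ≤ D) {n : ℕ} (hn : 1 ≤ n) {dhat : ℕ → ℝ} {fhat : ℕ → ℂ}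
    (hd : ∀ j ∈ Icc 1 n, δ ≤ dhat j ∧ dhat j ≤ D) (hf : ∀ j ∈ Icc 1 n, ‖fhat j‖ ≤ 1)
    {w : ℕ → ℝ} (hw : ∀ l ∈ Icc 1 n, variationIntegral θ n l ≤ W * w l) :
    meanError dhat n fhat ≤ D * (1 / δ + 1) *
      ((∑ j ∈ range (n + 1), pCoeff dhat j)⁻¹ * ∑ k ∈ Icc 1 n, ‖fhat k - 1‖ * pCoeff dhat (n - k) +
        4 * D * Real.exp D * W * (1 / (n : ℝ) ^ θ * ∑ k ∈ Icc 1 n, ‖fhat k - 1‖ * w k)) := by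
  have hn0 : (0 : ℝ) < n := by exact_mod_cast hn
  have h1n : 1 ∈ Icc 1 n := mem_Icc.2 ⟨le_rfl, hn⟩
  -- Values beyond `n` do not affect coefficients up to `n`; redefining them as `δ` and 1 makes the
  -- bounds hold for every index.
  set d : ℕ → ℝ := fun j => if j ∈ Icc 1 n then dhat j else δ with hd_def
  set f : ℕ → ℂ := fun j => if j ∈ Icc 1 n then fhat j else 1 with hf_def
  have hδD : δ ≤ D := (hd 1 h1n).1.trans (hd 1 h1n).2
  have hdδ : ∀ j, δ ≤ d j := fun j => by
    simp only [hd_def]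
    split_ifs with h
    exacts [(hd j h).1, le_rfl]
  have hdD : ∀ j, d j ≤ D := fun j => by
    simp only [hd_def]
    split_ifs with h
    exacts [(hd j h).2, hδD]
  have hf1 : ∀ j, ‖f j‖ ≤ 1 := fun j => by
    simp only [hf_def]
    split_ifs with h
    exacts [hf j h, by simp]
  have hdeq : ∀ j ∈ Icc 1 n, dhat j = d j := fun j hj => (if_pos hj).symm
  have hfeq : ∀ j ∈ Icc 1 n, fhat j = f j := fun j hj => (if_pos hj).symm
  clear_value d f
  have hp : ∀ k ≤ n, pCoeff dhat k = expCoeff d k := fun k hk => by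
    rw [pCoeff_eq_expCoeff]
    refine expCoeff_congr fun j hj => hdeq j ?_
    rw [mem_Icc] at hj ⊢
    omega
  have hP : ∑ j ∈ range (n + 1), pCoeff dhat j = ∑ j ∈ range (n + 1), expCoeff d j :=
    Finset.sum_congr rfl fun j hj => hp j (Nat.lt_succ_iff.1 (mem_range.1 hj))
  have hd0 : ∀ j, 0 < d j := fun j => hδ.trans_le (hdδ j)
  have hpn : 0 < expCoeff d n := expCoeff_pos hd0 n
  have hmean : meanError dhat n fhat = ‖expCoeff (fun j => (d j : ℂ) * f j) n -
      (expCoeff d n : ℝ) *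
        Complex.exp (∑ j ∈ Icc 1 n, (d j : ℂ) * ((f j - 1) / (j : ℂ)))‖ / expCoeff d n := by
    rw [meanError, weightedMean_eq, ← pCoeff_eq_expCoeff, hp n le_rfl,
      expCoeff_congr (b := fun j => (d j : ℂ) * f j)
        (fun j hj => by rw [hdeq j hj, hfeq j hj]),
      Finset.sum_congr rfl (g := fun j => (d j : ℂ) * ((f j - 1) / (j : ℂ)))
        (fun j hj => by rw [hdeq j hj, hfeq j hj])]
    exact norm_div_sub_eq hpn
  have hmain := norm_expCoeff_sub_exp_le hθ0 hθ1 (fun j => hθδ.trans (hdδ j)) hdD hf1 n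
  set S := ∑ i ∈ range (n + 1), expCoeff (fun j => d j - θ) i with hS
  set P := ∑ i ∈ range (n + 1), expCoeff d i with hP_def
  have hP0 : 0 < P := Finset.sum_pos (fun i _ => expCoeff_pos hd0 i) ⟨0, by simp⟩
  have hS0 : 0 ≤ S := Finset.sum_nonneg fun i _ =>
    expCoeff_nonneg (fun j => by linarith [hdδ j]) i
  have hSP : S ≤ 2 * Real.exp D * P / (n : ℝ) ^ θ := by
    rw [le_div_iff₀ (by positivity), mul_comm]
    exact sum_expCoeff_sub_le hθ0 hθ1 (fun j => hθδ.trans (hdδ j)) hdD hn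
  have hPn : 1 / (n * expCoeff d n) ≤ (1 / δ + 1) / P := by
    rw [div_le_div_iff₀ (by positivity) hP0, one_mul]
    exact sum_expCoeff_le_mul hδ hdδ hn
  clear_value S P
  rw [hmean, hP, div_le_iff₀ hpn]
  refine hmain.trans ?_
  rw [← div_le_iff₀ hpn, Finset.sum_div]
  -- The factor `P` in the bound for `S` cancels the 1/P coming from 1/(n p_n), so the second error
  -- term carries only n^(-θ).
  calc _ ≤ ∑ l ∈ Icc 1 n, D * ‖f l - 1‖ * (((1 / δ + 1) / P) *
        (expCoeff d (n - l) + 2 * D * (2 * Real.exp D * P / (n : ℝ) ^ θ) * (W * w l))) := by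
        refine Finset.sum_le_sum fun l hl => ?_
        have hJ : 0 ≤ variationIntegral θ n l :=
          intervalIntegral.integral_nonneg zero_le_one fun y hy =>
            mul_nonneg (pow_nonneg hy.1 _) (Real.exp_pos _).le
        have h1 : S * variationIntegral θ n l ≤
            2 * Real.exp D * P / (n : ℝ) ^ θ * (W * w l) :=
          mul_le_mul hSP (hw l hl) hJ (by positivity)
        have h2 : expCoeff d (n - l) + 2 * D * S * variationIntegral θ n l ≤
            expCoeff d (n - l) +
              2 * D * (2 * Real.exp D * P / (n : ℝ) ^ θ) * (W * w l) := by
          have := mul_le_mul_of_nonneg_left h1 (by positivity : 0 ≤ 2 * D)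
          linarith
        have h3 : 0 ≤ expCoeff d (n - l) + 2 * D * S * variationIntegral θ n l :=
          add_nonneg (expCoeff_pos hd0 _).le (by positivity)
        have h4 : D * ‖f l - 1‖ * ((expCoeff d (n - l) +
            2 * D * S * variationIntegral θ n l) / n) / expCoeff d n =
              D * ‖f l - 1‖ * (1 / (n * expCoeff d n) *
                (expCoeff d (n - l) + 2 * D * S * variationIntegral θ n l)) := by
          rw [one_div, mul_inv]
          ring
        have h5 : 0 ≤ D * ‖f l - 1‖ := by positivity
        have h6 : 0 ≤ (1 / δ + 1) / P := by positivity
        rw [h4]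
        have h7 := mul_le_mul hPn h2 h3 h6
        exact mul_le_mul_of_nonneg_left h7 h5
    _ = _ := by
        rw [Finset.mul_sum, Finset.mul_sum, Finset.mul_sum, ← Finset.sum_add_distrib,
          Finset.mul_sum]
        refine Finset.sum_congr rfl fun l hl => ?_
        rw [hp _ (Nat.sub_le n l), hfeq l hl]
        field_simp
        ring

theorem theorem3 (dminus dplus : ℝ) (hdminus : 0 < dminus) :
    ∃ c₁ : ℝ, 0 < c₁ ∧
      ∀ (n : ℕ), 1 ≤ n → ∀ (dhat : ℕ → ℝ) (fhat : ℕ → ℂ),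
        (∀ j ∈ Finset.Icc 1 n, dminus ≤ dhat j ∧ dhat j ≤ dplus) →
        (∀ j ∈ Finset.Icc 1 n, ‖fhat j‖ ≤ 1) →
          (∀ k : ℕ, pCoeff dhat k = PowerSeries.coeff k (genSeries dhat)) ∧
          (dminus < 1 →
            meanError dhat n fhat ≤
              c₁ * ((∑ j ∈ Finset.range (n + 1), pCoeff dhat j)⁻¹
                      * ∑ k ∈ Finset.Icc 1 n, ‖fhat k - 1‖ * pCoeff dhat (n - k)
                    + 1 / (n : ℝ) ^ dminus
                      * ∑ k ∈ Finset.Icc 1 n, ‖fhat k - 1‖ * (k : ℝ) ^ (dminus - 1)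
                    + 1 / (n : ℝ) * ∑ k ∈ Finset.Icc 1 n, ‖fhat k - 1‖)) ∧
          (1 ≤ dminus →
            meanError dhat n fhat ≤
              c₁ * ((∑ j ∈ Finset.range (n + 1), pCoeff dhat j)⁻¹
                      * ∑ k ∈ Finset.Icc 1 n, ‖fhat k - 1‖ * pCoeff dhat (n - k)
                    + 1 / (n : ℝ)
                      * ∑ k ∈ Finset.Icc 1 n,
                          ‖fhat k - 1‖ * (1 + Real.log ((n : ℝ) / (k : ℝ))))) := by
  -- The absolute value makes `D` nonnegative before any sequence is given.
  set D := |dplus| with hD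
  have hD0 : 0 ≤ D := abs_nonneg _
  set A := D * (1 / dminus + 1) with hA
  have hA0 : 0 ≤ A := by positivity
  -- One constant serves both cases; for `dminus = 1` the quotient is 0 by convention and the second
  -- summand suffices.
  set W := Real.exp 2 * (1 + 1 / |1 - dminus|) + 2 * Real.exp 2 with hW
  have hW0 : 0 ≤ W := by positivity
  set G := 4 * D * Real.exp D * W with hG
  have hG0 : 0 ≤ G := by positivity
  have hcombine : ∀ X Y Z : ℝ, 0 ≤ X → 0 ≤ Y → 0 ≤ Z →
      A * (X + G * Y) ≤ (A * (1 + G) + 1) * (X + Y + Z) := by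
    intro X Y Z hX hY hZ
    have h1 : 0 ≤ A * G := mul_nonneg hA0 hG0
    nlinarith [mul_nonneg h1 hX, mul_nonneg hA0 hY, mul_nonneg h1 hZ, mul_nonneg hA0 hZ]
  -- The summand 1 keeps the constant positive even when `A = 0`.
  refine ⟨A * (1 + G) + 1, by positivity, fun n hn dhat fhat hd hf => ?_⟩
  have hd' : ∀ j ∈ Icc 1 n, dminus ≤ dhat j ∧ dhat j ≤ D := fun j hj =>
    ⟨(hd j hj).1, (hd j hj).2.trans (le_abs_self _)⟩
  have hp0 : ∀ k ≤ n, 0 ≤ pCoeff dhat k := fun k hk => by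
    rw [pCoeff_eq_expCoeff, expCoeff_congr (b := fun j => max (dhat j) 0)]
    · exact expCoeff_nonneg (fun j => le_max_right _ _) k
    · intro j hj
      rw [mem_Icc] at hj
      exact (max_eq_left (hdminus.le.trans (hd j (mem_Icc.2 ⟨hj.1, hj.2.trans hk⟩)).1)).symm
  have hX : 0 ≤ (∑ j ∈ range (n + 1), pCoeff dhat j)⁻¹ *
      ∑ k ∈ Icc 1 n, ‖fhat k - 1‖ * pCoeff dhat (n - k) :=
    mul_nonneg (inv_nonneg.2 (Finset.sum_nonneg fun j hj =>
      hp0 j (Nat.lt_succ_iff.1 (mem_range.1 hj))))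
      (Finset.sum_nonneg fun k _ => mul_nonneg (norm_nonneg _) (hp0 _ (Nat.sub_le n k)))
  refine ⟨fun k => by rw [pCoeff_eq_expCoeff, genSeries_eq_expSeries]; rfl, fun h1 => ?_,
    fun h1 => ?_⟩
  · have hw : ∀ l ∈ Icc 1 n, variationIntegral dminus n l ≤ W * (l : ℝ) ^ (dminus - 1) := by
      intro l hl
      rw [mem_Icc] at hl
      refine (variationIntegral_le hdminus.le h1 hl.1).trans ?_
      refine mul_le_mul_of_nonneg_right ?_ (by positivity)
      rw [hW, abs_of_pos (sub_pos.2 h1)]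
      have := Real.exp_pos 2
      linarith
    refine (meanError_le hdminus hdminus.le h1.le le_rfl hD0 hn hd' hf hw).trans ?_
    exact hcombine _ _ _ hX (by positivity) (by positivity)
  · have hw : ∀ l ∈ Icc 1 n, variationIntegral 1 n l ≤ W * (1 + Real.log ((n : ℝ) / l)) := by
      intro l hl
      rw [mem_Icc] at hl
      refine (variationIntegral_one_le hl.1 hl.2).trans ?_
      have hlog : 0 ≤ Real.log ((n : ℝ) / l) :=
        Real.log_nonneg ((one_le_div (by exact_mod_cast hl.1)).2 (by exact_mod_cast hl.2))
      refine mul_le_mul_of_nonneg_right ?_ (by linarith)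
      have : 0 ≤ Real.exp 2 * (1 + 1 / |1 - dminus|) := by positivity
      linarith
    -- For `dminus ≥ 1` take θ = 1, the largest value for which the monotonicity argument applies.
    have hmain := meanError_le hdminus zero_le_one le_rfl h1 hD0 hn hd' hf hw
    rw [Real.rpow_one] at hmain
    refine hmain.trans ?_
    have hY : 0 ≤ 1 / (n : ℝ) *
        ∑ k ∈ Icc 1 n, ‖fhat k - 1‖ * (1 + Real.log ((n : ℝ) / (k : ℝ))) := by
      refine mul_nonneg (by positivity) (Finset.sum_nonneg fun k hk => ?_)
      rw [mem_Icc] at hk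
      have hlog : 0 ≤ Real.log ((n : ℝ) / k) :=
        Real.log_nonneg ((one_le_div (by exact_mod_cast hk.1)).2 (by exact_mod_cast hk.2))
      exact mul_nonneg (norm_nonneg _) (by linarith)
    simpa only [add_zero] using hcombine _ _ 0 hX hY le_rfl
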